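/- **Setting.** A *quantum graph* $\Gamma$ consists of finite sets $V$ of vertices and $E$ of edges, where each edge $e$ is a segment $[0,l_e]$, $l_e>0$, whose two ends are attached to vertices (loops and parallel edges are allowed; a loop then counts twice in the degree), together with complex $d_v\times d_v$ matrices $A_v,B_v$ at every vertex $v$, whose rows and columns are indexed by the $d_v$ edge ends at $v$. A function $f=(f|_e)_{e\in E}$, $f|_e:[0,l_e]\to\mathbb C$, satisfies the boundary conditions if $A_v f|_v+B_v f'|_v=0$ for all $v$, where $f|_v$ and $f'|_v$ are the vectors of values and of outgoing derivatives at the edge ends at $v$. The (negative) Laplacian of $\Gamma$ is the unbounded operator $f\mapsto(-f''|_e)_e$ on $L^2(\Gamma)=\bigoplus_e L^2([0,l_e])$ whose domain is the set of all $f$ with $f|_e\in W^{2,2}([0,l_e])$ for all $e$ that satisfy the boundary conditions. For $\lambda\in\mathbb C$ let $\Phi_\Gamma(\lambda)$ be the space of all $f$ in this domain with $-f''=\lambda f$, and $\sigma_\Gamma(\lambda)=\dim\Phi_\Gamma(\lambda)$. Let $G$ be a finite group acting on $\Gamma$, that is, on the vertices and on the edges (an edge may be mapped to an edge with reversed coordinate),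 preserving edge lengths, incidence and boundary conditions. Then $G$ acts on each $\Phi_\Gamma(\lambda)$ by $(gf)(x)=f(g^{-1}x)$. Let $R$ be a finite-dimensional complex representation of $G$, with homomorphism $\rho_R$, and let $d=\dim R$. A quantum graph $\Gamma'$ is a *$\Gamma/R$-graph* if $$\sigma_{\Gamma'}(\lambda)=\langle\chi_R,\chi_{\Phi_\Gamma(\lambda)}\rangle_G=\frac1{|G|}\sum_{g\in G}\chi_R(g)\overline{\chi_{\Phi_\Gamma(\lambda)}(g)}\qquad\text{for all }\lambda\in\mathbb C .$$ Suppose that $G$ acts freely on the vertices and freely on the edges. Choose representatives $\tilde v_k$ of the vertex orbits and $\tilde e^i$ of the edge orbits, and a basis $B=(b_1,\dots,b_d)$ of $R$. These choices determine a quantum graph, *constructed* as follows. Its vertices are $v_k$, one for each vertex orbit. Its edges are $e^i_j$, $1\le j\le d$, one such family for each edge orbit, where $e^i_j$ has the length of $\tilde e^i$, and each end of $e^i_j$ is attached to $v_k$ if the corresponding end of $\tilde e^i$ lies in the orbit of $\tilde v_k$. List the edge ends at $\tilde v_k$ as $h_l=g_l\tilde h_l$, $1\le l\le n$, with $g_l\in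 G$ and $\tilde h_l$ an end of a representing edge, and let $\Theta'$ be the $n\times n$ permutation matrix with $\Theta'_{ll'}=1$ iff $\tilde h_l$ is the $l'$-th of the ends of representing edges that lie over $v_k$. The boundary matrices at $v_k$ are, for $X\in\{A,B\}$, $$X_{v_k}=(X_{\tilde v_k}\otimes I_d)\cdot\operatorname{diag}\bigl([\rho_R(g_1^{-1})]_B,\dots,[\rho_R(g_n^{-1})]_B\bigr)^T\cdot(\Theta'\otimes I_d).$$ **Statement.** Let $\Gamma$ be a quantum graph whose Laplacian is self-adjoint, let $G$ be a finite group acting on $\Gamma$, freely on the vertices and on the edges, and let $R$ be any finite-dimensional complex representation of $G$. Then for every choice of orbit representatives of vertices and edges there is a basis $B$ of $R$ such that the quantum graph constructed from these choices is a $\Gamma/R$-graph and its Laplacian is self-adjoint. In particular a quotient $\Gamma/R$ with self-adjoint Laplacian can be constructed for every representation $R$ of $G$. -/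

import Mathlib

open MeasureTheory Set
open scoped Kronecker Matrix InnerProductSpace ComplexConjugate

universe u v w

/-- A finite metric graph. Loops and parallel edges are allowed. The edge `e` is the segment
`[0, len e]`; the end `false` of `e` is the point `0`, the end `true` is the point `len e`. -/
structure MetricGraph where
  V : Type u
  E : Type v
  finV : Finite V
  finE : Fintype E
  /-- the vertex at each of the two ends of an edge -/
  ends : E → Bool → V
  len : E → ℝ
  len_pos : ∀ e, 0 < len e

namespace MetricGraph

attribute [instance] MetricGraph.finV MetricGraph.finE

variable (M : MetricGraph.{u, v})

/-- The edge ends incident to a vertex. Without loops these are the edges incident to it. -/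
abbrev Star (p : M.V) : Type v := {h : M.E × Bool // M.ends h.1 h.2 = p}

noncomputable instance (p : M.V) : Fintype (M.Star p) := Fintype.ofFinite _

/-- The disjoint union of the edges `[0, len e]`. A function on the graph is a function
`M.Point → ℂ`. -/
abbrev Point : Type v := {p : M.E × ℝ // p.2 ∈ Icc (0 : ℝ) (M.len p.1)}

/-- The point of the edge `e` at one of its ends. -/
def endPoint (h : M.E × Bool) : M.Point :=
  ⟨(h.1, if h.2 then M.len h.1 else 0), by
    have := (M.len_pos h.1).le
    cases h.2 <;> simp [this]⟩

variable {M}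

open scoped Classical in
/-- The restriction of a function on the graph to an edge, set to `0` outside `[0, len e]`. -/
noncomputable def onEdge (f : M.Point → ℂ) (e : M.E) (x : ℝ) : ℂ :=
  if h : x ∈ Icc (0 : ℝ) (M.len e) then f ⟨(e, x), h⟩ else 0

/-- `f` is a `W^{2,2}` function on every edge, with (continuous) first derivative `f'` and
with second (weak) derivative `f''` in `L²`: on every edge `f'` is a primitive of `f''`, and `f`
is a primitive of `f'`. -/
structure IsSobolev (f f' f'' : M.Point → ℂ) : Prop where
  memLp : ∀ e, MemLp (onEdge f'' e) 2 (volume.restrict (Icc 0 (M.len e)))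
  deriv_eq : ∀ e, ∀ x ∈ Icc (0 : ℝ) (M.len e),
    onEdge f' e x = onEdge f' e 0 + ∫ t in (0 : ℝ)..x, onEdge f'' e t
  eq : ∀ e, ∀ x ∈ Icc (0 : ℝ) (M.len e),
    onEdge f e x = onEdge f e 0 + ∫ t in (0 : ℝ)..x, onEdge f' e t

/-- The value of `f` at an edge end. -/
def endValue (f : M.Point → ℂ) (h : M.E × Bool) : ℂ := f (M.endPoint h)

/-- The outgoing derivative at an edge end of a function whose derivative (with respect to the
coordinate of the edge) is `f'`. -/
def outDeriv (f' : M.Point → ℂ) (h : M.E × Bool) : ℂ :=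
  if h.2 then - f' (M.endPoint h) else f' (M.endPoint h)

/-- The Hilbert space `⨁ₑ L²([0, len e])`. -/
abbrev L2 (M : MetricGraph.{u, v}) : Type v :=
  PiLp 2 fun e : M.E => Lp ℂ 2 (volume.restrict (Icc (0 : ℝ) (M.len e)))

end MetricGraph

/-- A quantum graph: a metric graph with square matrices `A p`, `B p` of size the degree of `p`
at every vertex `p`. -/
structure QuantumGraph extends MetricGraph.{u, v} where
  A : ∀ p : V, Matrix (toMetricGraph.Star p) (toMetricGraph.Star p) ℂ
  B : ∀ p : V, Matrix (toMetricGraph.Star p) (toMetricGraph.Star p) ℂ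

namespace QuantumGraph

open MetricGraph

variable (Γ : QuantumGraph.{u, v})

/-- The boundary condition at the vertex `p`, for values `x` and outgoing derivatives `y` given
at all edge ends (only those at `p` matter). -/
def BoundaryCondition (p : Γ.V) (x y : Γ.E × Bool → ℂ) : Prop :=
  Γ.A p *ᵥ (fun h => x h.1) + Γ.B p *ᵥ (fun h => y h.1) = 0

/-- `f` lies in the domain of the Laplacian: it is in `W^{2,2}`, with derivatives `f'`, `f''`, and
satisfies the boundary conditions. -/
structure InDomain (f f' f'' : Γ.Point → ℂ) : Prop where
  sobolev : IsSobolev f f' f''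
  boundary : ∀ p, Γ.BoundaryCondition p (endValue f) (outDeriv f')

end QuantumGraph

namespace MetricGraph

variable {M : MetricGraph.{u, v}}

theorem onEdge_of_mem (f : M.Point → ℂ) {e : M.E} {x : ℝ} (h : x ∈ Icc (0 : ℝ) (M.len e)) :
    onEdge f e x = f ⟨(e, x), h⟩ := dif_pos h

theorem onEdge_add (f g : M.Point → ℂ) (e : M.E) :
    onEdge (f + g) e = onEdge f e + onEdge g e := by
  funext x
  by_cases h : x ∈ Icc (0 : ℝ) (M.len e) <;> simp only [onEdge, Pi.add_apply, h] <;> simp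

theorem onEdge_smul (c : ℂ) (f : M.Point → ℂ) (e : M.E) :
    onEdge (c • f) e = c • onEdge f e := by
  funext x
  by_cases h : x ∈ Icc (0 : ℝ) (M.len e) <;> simp only [onEdge, Pi.smul_apply, h] <;> simp

theorem onEdge_zero (e : M.E) : onEdge (0 : M.Point → ℂ) e = 0 := by
  funext x
  simp [onEdge]

theorem zero_mem_edge (e : M.E) : (0 : ℝ) ∈ Icc (0 : ℝ) (M.len e) := ⟨le_rfl, (M.len_pos e).le⟩

namespace IsSobolev

variable {f f' f'' : M.Point → ℂ}

theorem integrable_snd (hf : IsSobolev f f' f'') (e : M.E) :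
    IntegrableOn (onEdge f'' e) (Icc 0 (M.len e)) :=
  (hf.memLp e).integrable (by norm_num)

theorem intervalIntegrable_snd (hf : IsSobolev f f' f'') (e : M.E) :
    IntervalIntegrable (onEdge f'' e) volume 0 (M.len e) := by
  rw [intervalIntegrable_iff_integrableOn_Icc_of_le (M.len_pos e).le]
  exact hf.integrable_snd e

theorem continuousOn_fst (hf : IsSobolev f f' f'') (e : M.E) :
    ContinuousOn (onEdge f' e) (Icc 0 (M.len e)) := by
  have h := intervalIntegral.continuousOn_primitive_interval (f := onEdge f'' e)
    (a := 0) (b := M.len e) (μ := volume)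
    (by rw [uIcc_of_le (M.len_pos e).le]; exact hf.integrable_snd e)
  rw [uIcc_of_le (M.len_pos e).le] at h
  exact (continuousOn_const.add h).congr (hf.deriv_eq e)

theorem intervalIntegrable_fst (hf : IsSobolev f f' f'') (e : M.E) :
    IntervalIntegrable (onEdge f' e) volume 0 (M.len e) := by
  apply ContinuousOn.intervalIntegrable
  rw [uIcc_of_le (M.len_pos e).le]
  exact hf.continuousOn_fst e

theorem continuousOn (hf : IsSobolev f f' f'') (e : M.E) :
    ContinuousOn (onEdge f e) (Icc 0 (M.len e)) := by
  have h := intervalIntegral.continuousOn_primitive_interval (f := onEdge f' e)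
    (a := 0) (b := M.len e) (μ := volume)
    (by rw [uIcc_of_le (M.len_pos e).le]
        exact (hf.continuousOn_fst e).integrableOn_Icc)
  rw [uIcc_of_le (M.len_pos e).le] at h
  exact (continuousOn_const.add h).congr (hf.eq e)

theorem intervalIntegrable_of {F : ℝ → ℂ} {l x : ℝ} (h : IntervalIntegrable F volume 0 l)
    (hx : x ∈ Icc (0 : ℝ) l) : IntervalIntegrable F volume 0 x :=
  h.mono_set (by
    rw [uIcc_of_le hx.1, uIcc_of_le (hx.1.trans hx.2)]
    exact Icc_subset_Icc le_rfl hx.2)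

theorem zero : IsSobolev (0 : M.Point → ℂ) 0 0 := by
  constructor <;> intro e <;> simp only [onEdge_zero]
  · exact MemLp.zero
  · intro x _; simp
  · intro x _; simp

theorem add {g g' g'' : M.Point → ℂ} (hf : IsSobolev f f' f'') (hg : IsSobolev g g' g'') :
    IsSobolev (f + g) (f' + g') (f'' + g'') := by
  constructor <;> intro e <;> simp only [onEdge_add]
  · exact (hf.memLp e).add (hg.memLp e)
  · intro x hx
    simp only [Pi.add_apply]
    rw [intervalIntegral.integral_add (intervalIntegrable_of (hf.intervalIntegrable_snd e) hx)
      (intervalIntegrable_of (hg.intervalIntegrable_snd e) hx), hf.deriv_eq e x hx,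
      hg.deriv_eq e x hx]
    ring
  · intro x hx
    simp only [Pi.add_apply]
    rw [intervalIntegral.integral_add (intervalIntegrable_of (hf.intervalIntegrable_fst e) hx)
      (intervalIntegrable_of (hg.intervalIntegrable_fst e) hx), hf.eq e x hx, hg.eq e x hx]
    ring

theorem smul (c : ℂ) (hf : IsSobolev f f' f'') : IsSobolev (c • f) (c • f') (c • f'') := by
  constructor <;> intro e <;> simp only [onEdge_smul]
  · exact (hf.memLp e).const_smul c
  · intro x hx
    simp only [Pi.smul_apply]
    rw [intervalIntegral.integral_smul, hf.deriv_eq e x hx, smul_add]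
  · intro x hx
    simp only [Pi.smul_apply]
    rw [intervalIntegral.integral_smul, hf.eq e x hx, smul_add]

/-- If the integrals of `F` over all `[0, x]`, `x ≤ l`, vanish then `F` vanishes almost
everywhere on `[0, l]`. -/
theorem ae_zero_of_primitive {F : ℝ → ℂ} {l : ℝ} (hl : 0 < l)
    (hF : IntervalIntegrable F volume 0 l)
    (h : ∀ x ∈ Icc (0 : ℝ) l, ∫ t in (0 : ℝ)..x, F t = 0) :
    ∀ᵐ x ∂(volume.restrict (Icc 0 l)), F x = 0 := by
  rw [← restrict_Ioo_eq_restrict_Icc, ae_restrict_iff' measurableSet_Ioo]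
  filter_upwards [hF.ae_hasDerivAt_integral] with x hx hxm
  have hm : x ∈ uIcc 0 l := by rw [uIcc_of_le hl.le]; exact Ioo_subset_Icc_self hxm
  have h1 := hx hm 0 left_mem_uIcc
  have h2 : HasDerivAt (fun y => ∫ t in (0 : ℝ)..y, F t) 0 x := by
    refine (hasDerivAt_const x (0 : ℂ)).congr_of_eventuallyEq ?_
    filter_upwards [Ioo_mem_nhds hxm.1 hxm.2] with y hy
    exact h y (Ioo_subset_Icc_self hy)
  exact h1.unique h2

theorem eqOn_zero {F : ℝ → ℂ} {l : ℝ} (hl : 0 < l) (hF : ContinuousOn F (Icc 0 l))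
    (h : ∀ᵐ x ∂(volume.restrict (Icc 0 l)), F x = 0) : ∀ x ∈ Icc (0 : ℝ) l, F x = 0 :=
  Measure.eqOn_Icc_of_ae_eq volume hl.ne h hF continuousOn_const

/-- A `W^{2,2}` function that vanishes almost everywhere has second derivative zero. -/
theorem snd_ae_zero (hf : IsSobolev f f' f'') (e : M.E)
    (h : ∀ᵐ x ∂(volume.restrict (Icc 0 (M.len e))), onEdge f e x = 0) :
    ∀ᵐ x ∂(volume.restrict (Icc 0 (M.len e))), onEdge f'' e x = 0 := by
  have hl := M.len_pos e
  have h0 := eqOn_zero hl (hf.continuousOn e) h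
  have h1 := eqOn_zero hl (hf.continuousOn_fst e) <|
    ae_zero_of_primitive hl (hf.intervalIntegrable_fst e) fun x hx => by
      have := hf.eq e x hx
      rw [h0 x hx, h0 0 (zero_mem_edge e), zero_add] at this
      exact this.symm
  exact ae_zero_of_primitive hl (hf.intervalIntegrable_snd e) fun x hx => by
      have := hf.deriv_eq e x hx
      rw [h1 x hx, h1 0 (zero_mem_edge e), zero_add] at this
      exact this.symm

end IsSobolev

theorem endValue_add (f g : M.Point → ℂ) : endValue (f + g) = endValue f + endValue g := rfl

theorem endValue_smul (c : ℂ) (f : M.Point → ℂ) : endValue (c • f) = c • endValue f := rfl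

theorem outDeriv_add (f g : M.Point → ℂ) : outDeriv (f + g) = outDeriv f + outDeriv g := by
  funext h
  rcases h with ⟨e, _ | _⟩ <;> simp [outDeriv, add_comm]

theorem outDeriv_smul (c : ℂ) (f : M.Point → ℂ) : outDeriv (c • f) = c • outDeriv f := by
  funext h
  rcases h with ⟨e, _ | _⟩ <;> simp [outDeriv]

end MetricGraph

namespace QuantumGraph

open MetricGraph

variable {Γ : QuantumGraph.{u, v}}

theorem BoundaryCondition.add {p : Γ.V} {x y x' y' : Γ.E × Bool → ℂ}
    (h : Γ.BoundaryCondition p x y) (h' : Γ.BoundaryCondition p x' y') :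
    Γ.BoundaryCondition p (x + x') (y + y') := by
  unfold BoundaryCondition at *
  have := congrArg₂ (· + ·) h h'
  simp only [add_zero] at this
  rw [← this]
  change Γ.A p *ᵥ ((fun h => x h.1) + fun h => x' h.1)
    + Γ.B p *ᵥ ((fun h => y h.1) + fun h => y' h.1) = _
  rw [Matrix.mulVec_add, Matrix.mulVec_add]
  abel

theorem BoundaryCondition.smul (c : ℂ) {p : Γ.V} {x y : Γ.E × Bool → ℂ}
    (h : Γ.BoundaryCondition p x y) : Γ.BoundaryCondition p (c • x) (c • y) := by
  unfold BoundaryCondition at *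
  change Γ.A p *ᵥ (c • fun h => x h.1) + Γ.B p *ᵥ (c • fun h => y h.1) = _
  rw [Matrix.mulVec_smul, Matrix.mulVec_smul, ← smul_add, h, smul_zero]

theorem InDomain.zero : Γ.InDomain 0 0 0 where
  sobolev := IsSobolev.zero
  boundary p := by
    have h1 : endValue (0 : Γ.Point → ℂ) = 0 := rfl
    have h2 : outDeriv (0 : Γ.Point → ℂ) = 0 := by funext h; simp [outDeriv]
    rw [h1, h2]
    change Γ.A p *ᵥ 0 + Γ.B p *ᵥ 0 = 0
    simp

theorem InDomain.add {f f' f'' g g' g'' : Γ.Point → ℂ} (hf : Γ.InDomain f f' f'')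
    (hg : Γ.InDomain g g' g'') : Γ.InDomain (f + g) (f' + g') (f'' + g'') where
  sobolev := hf.sobolev.add hg.sobolev
  boundary p := by
    rw [endValue_add, outDeriv_add]
    exact (hf.boundary p).add (hg.boundary p)

theorem InDomain.smul (c : ℂ) {f f' f'' : Γ.Point → ℂ} (hf : Γ.InDomain f f' f'') :
    Γ.InDomain (c • f) (c • f') (c • f'') where
  sobolev := hf.sobolev.smul c
  boundary p := by
    rw [endValue_smul, outDeriv_smul]
    exact (hf.boundary p).smul c

variable (Γ)

/-- The graph of the negative Laplacian `-f''` in `L²(Γ) × L²(Γ)`. -/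
def laplacianGraph : Submodule ℂ (Γ.L2 × Γ.L2) where
  carrier := {P | ∃ f f' f'' : Γ.Point → ℂ, Γ.InDomain f f' f'' ∧
    ∀ e, (∀ᵐ x ∂(volume.restrict (Icc 0 (Γ.len e))), P.1 e x = onEdge f e x) ∧
      (∀ᵐ x ∂(volume.restrict (Icc 0 (Γ.len e))), P.2 e x = - onEdge f'' e x)}
  zero_mem' := by
    refine ⟨0, 0, 0, InDomain.zero, fun e => ⟨?_, ?_⟩⟩
    · filter_upwards [Lp.coeFn_zero ℂ 2 (volume.restrict (Icc 0 (Γ.len e)))] with x hx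
      rw [onEdge_zero]; exact hx
    · filter_upwards [Lp.coeFn_zero ℂ 2 (volume.restrict (Icc 0 (Γ.len e)))] with x hx
      rw [onEdge_zero, Pi.zero_apply, neg_zero]; exact hx
  add_mem' := by
    rintro P Q ⟨f, f', f'', hf, hP⟩ ⟨g, g', g'', hg, hQ⟩
    refine ⟨f + g, f' + g', f'' + g'', hf.add hg, fun e => ⟨?_, ?_⟩⟩
    · filter_upwards [(hP e).1, (hQ e).1, Lp.coeFn_add (P.1 e) (Q.1 e)] with x h1 h2 h3
      rw [onEdge_add, Pi.add_apply, ← h1, ← h2]; exact h3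
    · filter_upwards [(hP e).2, (hQ e).2, Lp.coeFn_add (P.2 e) (Q.2 e)] with x h1 h2 h3
      rw [onEdge_add, Pi.add_apply, neg_add, ← h1, ← h2]; exact h3
  smul_mem' := by
    rintro c P ⟨f, f', f'', hf, hP⟩
    refine ⟨c • f, c • f', c • f'', hf.smul c, fun e => ⟨?_, ?_⟩⟩
    · filter_upwards [(hP e).1, Lp.coeFn_smul c (P.1 e)] with x h1 h3
      rw [onEdge_smul, Pi.smul_apply, ← h1]; exact h3
    · filter_upwards [(hP e).2, Lp.coeFn_smul c (P.2 e)] with x h1 h3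
      rw [onEdge_smul, Pi.smul_apply, ← smul_neg, ← h1]; exact h3

/-- The negative Laplacian of a quantum graph, an unbounded operator on `L²(Γ)`. -/
noncomputable def laplacian : Γ.L2 →ₗ.[ℂ] Γ.L2 := Γ.laplacianGraph.toLinearPMap

/-- The graph of the Laplacian is `laplacianGraph`: the second derivative is well defined. -/
theorem graph_laplacian : Γ.laplacian.graph = Γ.laplacianGraph := by
  refine Submodule.toLinearPMap_graph_eq _ ?_
  rintro P ⟨f, f', f'', hf, hP⟩ h0
  ext e : 1
  apply Lp.ext
  have hz : ∀ᵐ x ∂(volume.restrict (Icc 0 (Γ.len e))), onEdge f e x = 0 := by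
    filter_upwards [(hP e).1, Lp.coeFn_zero ℂ 2 (volume.restrict (Icc 0 (Γ.len e)))] with x h1 h2
    rw [← h1, h0]; exact h2
  filter_upwards [(hP e).2, hf.sobolev.snd_ae_zero e hz,
    Lp.coeFn_zero ℂ 2 (volume.restrict (Icc 0 (Γ.len e)))] with x h1 h2 h3
  rw [h1, h2, neg_zero]; exact h3.symm

/-- The eigenspace: all functions in the domain of the Laplacian with `-f'' = lam f`. -/
def eigenspace (lam : ℂ) : Submodule ℂ (Γ.Point → ℂ) where
  carrier := {f | ∃ f' f'' : Γ.Point → ℂ, Γ.InDomain f f' f'' ∧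
    ∀ e, ∀ᵐ x ∂(volume.restrict (Icc 0 (Γ.len e))), - onEdge f'' e x = lam * onEdge f e x}
  zero_mem' := ⟨0, 0, InDomain.zero, fun e => by simp [onEdge_zero]⟩
  add_mem' := by
    rintro f g ⟨f', f'', hf, h⟩ ⟨g', g'', hg, h'⟩
    refine ⟨f' + g', f'' + g'', hf.add hg, fun e => ?_⟩
    filter_upwards [h e, h' e] with x h1 h2
    rw [onEdge_add, onEdge_add, Pi.add_apply, Pi.add_apply, neg_add, h1, h2, mul_add]
  smul_mem' := by
    rintro c f ⟨f', f'', hf, h⟩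
    refine ⟨c • f', c • f'', hf.smul c, fun e => ?_⟩
    filter_upwards [h e] with x h1
    rw [onEdge_smul, onEdge_smul, Pi.smul_apply, Pi.smul_apply, ← smul_neg, h1]
    simp only [smul_eq_mul]; ring

/-- The spectrum of a quantum graph: each eigenvalue with its multiplicity. -/
noncomputable def spectrum (lam : ℂ) : ℕ := Module.finrank ℂ (Γ.eigenspace lam)

/-- Given actions of `G` on the vertices and on the edges, the additional data and the
properties that make them an action on the quantum graph: `rev g e` tells whether `g` maps the
edge `e` to the edge `g • e` with reversed coordinate; lengths, incidence and boundary conditions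
are preserved. -/
structure Symmetry (G : Type w) [Group G] [MulAction G Γ.V] [MulAction G Γ.E] where
  rev : G → Γ.E → Bool
  rev_mul : ∀ g h e, rev (g * h) e = xor (rev g (h • e)) (rev h e)
  len_smul : ∀ (g : G) e, Γ.len (g • e) = Γ.len e
  ends_smul : ∀ (g : G) e b, Γ.ends (g • e) (xor b (rev g e)) = g • Γ.ends e b
  boundary_smul : ∀ (g : G) (p : Γ.V) (x y : Γ.E × Bool → ℂ),
    Γ.BoundaryCondition (g • p) x y ↔
      Γ.BoundaryCondition p (fun h => x (g • h.1, xor h.2 (rev g h.1)))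
        (fun h => y (g • h.1, xor h.2 (rev g h.1)))

end QuantumGraph

namespace QuantumGraph.Symmetry

open MetricGraph

variable {Γ : QuantumGraph.{u, v}} {G : Type w} [Group G] [MulAction G Γ.V] [MulAction G Γ.E]
  (S : Γ.Symmetry G)

theorem rev_one (e : Γ.E) : S.rev 1 e = false := by
  have h := S.rev_mul 1 1 e
  rw [mul_one, one_smul] at h
  cases hr : S.rev 1 e <;> simp_all

/-- The action on the points of the graph. -/
def movePoint (g : G) (p : Γ.Point) : Γ.Point :=
  ⟨(g • p.1.1, if S.rev g p.1.1 then Γ.len p.1.1 - p.1.2 else p.1.2), by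
    have h := p.2
    have hl := S.len_smul g p.1.1
    simp only [mem_Icc] at h ⊢
    rw [hl]
    split <;> constructor <;> linarith [h.1, h.2]⟩

/-- The action on the edge ends. -/
def moveEnd (g : G) (h : Γ.E × Bool) : Γ.E × Bool := (g • h.1, xor h.2 (S.rev g h.1))

theorem movePoint_one (p : Γ.Point) : S.movePoint 1 p = p := by
  apply Subtype.ext
  simp [movePoint, S.rev_one]

theorem movePoint_mul (g h : G) (p : Γ.Point) :
    S.movePoint (g * h) p = S.movePoint g (S.movePoint h p) := by
  apply Subtype.ext
  simp only [movePoint, mul_smul, S.rev_mul, S.len_smul]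
  cases S.rev g (h • p.1.1) <;> cases S.rev h p.1.1 <;> simp

theorem moveEnd_one (h : Γ.E × Bool) : S.moveEnd 1 h = h := by
  simp [moveEnd, S.rev_one]

theorem moveEnd_mul (g k : G) (h : Γ.E × Bool) :
    S.moveEnd (g * k) h = S.moveEnd g (S.moveEnd k h) := by
  simp only [moveEnd, mul_smul, S.rev_mul]
  cases S.rev g (k • h.1) <;> cases S.rev k h.1 <;> simp

theorem movePoint_endPoint (g : G) (h : Γ.E × Bool) :
    S.movePoint g (Γ.endPoint h) = Γ.endPoint (S.moveEnd g h) := by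
  apply Subtype.ext
  rcases h with ⟨e, _ | _⟩ <;> cases hr : S.rev g e <;>
    simp [movePoint, moveEnd, endPoint, hr, S.len_smul]

/-- The representation of `G` on all functions on the graph, `(g f)(p) = f (g⁻¹ p)`. -/
def functionRep : Representation ℂ G (Γ.Point → ℂ) where
  toFun g := LinearMap.funLeft ℂ ℂ (S.movePoint g⁻¹)
  map_one' := by
    ext f p
    simp [LinearMap.funLeft_apply, S.movePoint_one]
  map_mul' g h := by
    apply LinearMap.ext
    intro f
    funext p
    change f _ = f _
    rw [mul_inv_rev, S.movePoint_mul]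

/-- The derivative (along the edges) of `g f`, when `f'` is the derivative of `f`. -/
def moveDeriv (g : G) (f' : Γ.Point → ℂ) (p : Γ.Point) : ℂ :=
  if S.rev g⁻¹ p.1.1 then - f' (S.movePoint g⁻¹ p) else f' (S.movePoint g⁻¹ p)

theorem onEdge_functionRep (g : G) (f : Γ.Point → ℂ) (e : Γ.E) (x : ℝ) :
    onEdge (S.functionRep g f) e x =
      onEdge f (g⁻¹ • e) (if S.rev g⁻¹ e then Γ.len e - x else x) := by
  by_cases hx : x ∈ Icc (0 : ℝ) (Γ.len e)
  · have hx' := (S.movePoint g⁻¹ ⟨(e, x), hx⟩).2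
    rw [onEdge_of_mem _ hx]
    exact (onEdge_of_mem f hx').symm
  · have hx' : ¬ (if S.rev g⁻¹ e then Γ.len e - x else x) ∈ Icc (0 : ℝ) (Γ.len (g⁻¹ • e)) := by
      rw [S.len_smul]
      intro h
      apply hx
      cases hr : S.rev g⁻¹ e <;> simp only [hr, mem_Icc] at h ⊢ <;> simp at h <;>
        constructor <;> linarith [h.1, h.2]
    simp only [onEdge]
    rw [dif_neg hx, dif_neg hx']

theorem onEdge_moveDeriv (g : G) (f' : Γ.Point → ℂ) (e : Γ.E) (x : ℝ) :
    onEdge (S.moveDeriv g f') e x =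
      if S.rev g⁻¹ e then - onEdge f' (g⁻¹ • e) (Γ.len e - x) else onEdge f' (g⁻¹ • e) x := by
  have h := S.onEdge_functionRep g f' e x
  by_cases hx : x ∈ Icc (0 : ℝ) (Γ.len e)
  · rw [onEdge_of_mem _ hx] at h ⊢
    have h' : f' (S.movePoint g⁻¹ ⟨(e, x), hx⟩) = _ := h
    simp only [moveDeriv, h']
    cases S.rev g⁻¹ e <;> simp
  · have h1 : onEdge (S.moveDeriv g f') e x = 0 := dif_neg hx
    have h2 : onEdge (S.functionRep g f') e x = 0 := dif_neg hx
    rw [h2] at h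
    rw [h1]
    cases hr : S.rev g⁻¹ e <;> simp only [hr, Bool.false_eq_true, if_false, if_true] at h ⊢ <;>
      simp [← h]

theorem primitive_reflect {F F' : ℝ → ℂ} {l : ℝ} (hl : 0 < l)
    (hi : IntervalIntegrable F' volume 0 l)
    (h : ∀ x ∈ Icc (0 : ℝ) l, F x = F 0 + ∫ t in (0 : ℝ)..x, F' t) :
    ∀ x ∈ Icc (0 : ℝ) l, F (l - x) = F (l - 0) + ∫ t in (0 : ℝ)..x, - F' (l - t) := by
  intro x hx
  have hx' : l - x ∈ Icc (0 : ℝ) l := ⟨by linarith [hx.2], by linarith [hx.1]⟩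
  have hl' : l ∈ Icc (0 : ℝ) l := ⟨hl.le, le_rfl⟩
  rw [intervalIntegral.integral_neg, intervalIntegral.integral_comp_sub_left, sub_zero,
    h _ hx', h l hl', ← intervalIntegral.integral_interval_sub_left hi
      (IsSobolev.intervalIntegrable_of hi hx')]
  ring

theorem isSobolev_move (g : G) {f f' f'' : Γ.Point → ℂ} (hf : IsSobolev f f' f'') :
    IsSobolev (S.functionRep g f) (S.moveDeriv g f') (S.functionRep g f'') := by
  have e1 : ∀ (k : Γ.Point → ℂ) (e : Γ.E), onEdge (S.functionRep g k) e =
      fun x => onEdge k (g⁻¹ • e) (if S.rev g⁻¹ e then Γ.len e - x else x) :=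
    fun k e => funext (S.onEdge_functionRep g k e)
  have e2 : ∀ (e : Γ.E), onEdge (S.moveDeriv g f') e = fun x =>
      if S.rev g⁻¹ e then - onEdge f' (g⁻¹ • e) (Γ.len e - x) else onEdge f' (g⁻¹ • e) x :=
    fun e => funext (S.onEdge_moveDeriv g f' e)
  constructor <;> intro e
  · have hm := hf.memLp (g⁻¹ • e)
    rw [S.len_smul] at hm
    rw [e1]
    cases hr : S.rev g⁻¹ e
    · simpa using hm
    · simp only [if_true]
      have hp : MeasurePreserving (fun x : ℝ => Γ.len e - x)
          (volume.restrict (Icc 0 (Γ.len e))) (volume.restrict (Icc 0 (Γ.len e))) := by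
        have := (Measure.measurePreserving_sub_left (volume : Measure ℝ) (Γ.len e)).restrict_preimage
          (s := Icc 0 (Γ.len e)) measurableSet_Icc
        simpa using this
      exact hm.comp_measurePreserving hp
  · have h := hf.deriv_eq (g⁻¹ • e)
    have hi := hf.intervalIntegrable_snd (g⁻¹ • e)
    rw [S.len_smul] at h hi
    rw [e1, e2]
    cases hr : S.rev g⁻¹ e
    · simpa using h
    · intro x hx
      have := primitive_reflect (Γ.len_pos e) hi h x hx
      simp only [if_true]
      rw [this, intervalIntegral.integral_neg]
      ring
  · have h := hf.eq (g⁻¹ • e)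
    have hi := hf.intervalIntegrable_fst (g⁻¹ • e)
    rw [S.len_smul] at h hi
    rw [e1, e2]
    cases hr : S.rev g⁻¹ e
    · simpa using h
    · intro x hx
      have := primitive_reflect (Γ.len_pos e) hi h x hx
      simpa only [if_true] using this

theorem endValue_move (g : G) (f : Γ.Point → ℂ) (h : Γ.E × Bool) :
    endValue (S.functionRep g f) (S.moveEnd g h) = endValue f h := by
  change f (S.movePoint g⁻¹ (Γ.endPoint (S.moveEnd g h))) = f (Γ.endPoint h)
  rw [movePoint_endPoint, ← moveEnd_mul, inv_mul_cancel, moveEnd_one]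

theorem outDeriv_move (g : G) (f' : Γ.Point → ℂ) (h : Γ.E × Bool) :
    outDeriv (S.moveDeriv g f') (S.moveEnd g h) = outDeriv f' h := by
  have h1 : S.movePoint g⁻¹ (Γ.endPoint (S.moveEnd g h)) = Γ.endPoint h := by
    rw [movePoint_endPoint, ← moveEnd_mul, inv_mul_cancel, moveEnd_one]
  have h2 : S.rev g⁻¹ (g • h.1) = S.rev g h.1 := by
    have := S.rev_mul g⁻¹ g h.1
    rw [inv_mul_cancel, rev_one] at this
    cases h3 : S.rev g h.1 <;> simp_all
  have h3 : (Γ.endPoint (S.moveEnd g h)).1.1 = g • h.1 := rfl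
  have h4 : (S.moveEnd g h).2 = xor h.2 (S.rev g h.1) := rfl
  simp only [outDeriv, moveDeriv, h1, h2, h3, h4]
  cases h.2 <;> cases S.rev g h.1 <;> simp

theorem inDomain_move (g : G) {f f' f'' : Γ.Point → ℂ} (hf : Γ.InDomain f f' f'') :
    Γ.InDomain (S.functionRep g f) (S.moveDeriv g f') (S.functionRep g f'') where
  sobolev := S.isSobolev_move g hf.sobolev
  boundary p := by
    have h := (S.boundary_smul g (g⁻¹ • p) (endValue (S.functionRep g f))
      (outDeriv (S.moveDeriv g f'))).2 (by
        have hb := hf.boundary (g⁻¹ • p)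
        have e1 : (fun h : Γ.E × Bool => endValue (S.functionRep g f)
            (g • h.1, xor h.2 (S.rev g h.1))) = endValue f :=
          funext fun h => S.endValue_move g f h
        have e2 : (fun h : Γ.E × Bool => outDeriv (S.moveDeriv g f')
            (g • h.1, xor h.2 (S.rev g h.1))) = outDeriv f' :=
          funext fun h => S.outDeriv_move g f' h
        rw [e1, e2]
        exact hb)
    rwa [smul_inv_smul] at h

theorem eigenspace_move (g : G) (lam : ℂ) :
    ∀ f ∈ Γ.eigenspace lam, S.functionRep g f ∈ Γ.eigenspace lam := by
  rintro f ⟨f', f'', hf, h⟩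
  refine ⟨S.moveDeriv g f', S.functionRep g f'', S.inDomain_move g hf, fun e => ?_⟩
  have he := h (g⁻¹ • e)
  rw [S.len_smul] at he
  simp only [onEdge_functionRep]
  cases hr : S.rev g⁻¹ e
  · simpa using he
  · simp only [if_true]
    have hp : MeasurePreserving (fun x : ℝ => Γ.len e - x)
        (volume.restrict (Icc 0 (Γ.len e))) (volume.restrict (Icc 0 (Γ.len e))) := by
      have := (Measure.measurePreserving_sub_left (volume : Measure ℝ) (Γ.len e)).restrict_preimage
        (s := Icc 0 (Γ.len e)) measurableSet_Icc
      simpa using this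
    exact hp.quasiMeasurePreserving.ae he

/-- The representation of `G` carried by an eigenspace. -/
def eigenRep (lam : ℂ) : Representation ℂ G (Γ.eigenspace lam) where
  toFun g := (S.functionRep g).restrict (S.eigenspace_move g lam)
  map_one' := by
    apply LinearMap.ext
    intro f
    apply Subtype.ext
    simp [LinearMap.restrict_apply]
  map_mul' g h := by
    apply LinearMap.ext
    intro f
    apply Subtype.ext
    simp [LinearMap.restrict_apply]

/-- The `R`-spectrum of `Γ`, that is `⟨χ_R, χ_Φ⟩_G` for the eigenspace `Φ`. -/
noncomputable def repSpectrum [Fintype G] {W : Type*} [AddCommGroup W] [Module ℂ W]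
    (R : Representation ℂ G W) (lam : ℂ) : ℂ :=
  (Fintype.card G : ℂ)⁻¹ * ∑ g : G, R.character g * conj ((S.eigenRep lam).character g)

/-- `Γ'` is a `Γ/R`-graph: its spectrum is the `R`-spectrum of `Γ`. -/
def IsQuotientGraph [Fintype G] {W : Type*} [AddCommGroup W] [Module ℂ W]
    (R : Representation ℂ G W) (Γ' : QuantumGraph) : Prop :=
  ∀ lam : ℂ, (Γ'.spectrum lam : ℂ) = S.repSpectrum R lam

end QuantumGraph.Symmetry

namespace QuantumGraph

open MetricGraph MulAction

variable (Γ : QuantumGraph.{u, v}) (G : Type w) [Group G] [MulAction G Γ.V] [MulAction G Γ.E]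

/-- A choice of representatives for the orbits of the vertices and of the edges. -/
structure OrbitReps where
  vRep : orbitRel.Quotient G Γ.V → Γ.V
  eRep : orbitRel.Quotient G Γ.E → Γ.E
  mk_vRep : ∀ k, (Quotient.mk _ (vRep k) : orbitRel.Quotient G Γ.V) = k
  mk_eRep : ∀ i, (Quotient.mk _ (eRep i) : orbitRel.Quotient G Γ.E) = i

instance : Nonempty (Γ.OrbitReps G) :=
  ⟨⟨Quotient.out, Quotient.out, fun k => Quotient.out_eq k, fun i => Quotient.out_eq i⟩⟩

namespace OrbitReps

variable {Γ G}
variable (S : Γ.Symmetry G) (T : Γ.OrbitReps G)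

theorem exists_smul_eRep (e : Γ.E) :
    ∃ g : G, g • T.eRep (Quotient.mk _ e) = e :=
  let ⟨g, hg⟩ := Quotient.exact (T.mk_eRep (Quotient.mk _ e)).symm
  ⟨g, hg⟩

/-- For an edge `e`, an element `g` with `e = g ẽ`, where `ẽ` represents the orbit of `e` (it is
unique if the action on the edges is free). -/
noncomputable def elt (e : Γ.E) : G := (T.exists_smul_eRep e).choose

theorem elt_spec (e : Γ.E) : T.elt e • T.eRep (Quotient.mk _ e) = e :=
  (T.exists_smul_eRep e).choose_spec

/-- The metric graph underlying the quotient: the vertices are the vertex orbits, and every edge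
orbit gives `d` edges, of the length of its representative, joining the orbits of the vertices of
the representative. -/
noncomputable def metricGraph (d : ℕ) : MetricGraph where
  V := orbitRel.Quotient G Γ.V
  E := orbitRel.Quotient G Γ.E × Fin d
  finV := inferInstanceAs (Finite (Quotient _))
  finE := @Fintype.ofFinite _ (@Finite.instProd _ _ (inferInstanceAs (Finite (Quotient _))) _)
  ends e b := Quotient.mk _ (Γ.ends (T.eRep e.1) b)
  len e := Γ.len (T.eRep e.1)
  len_pos _ := Γ.len_pos _

/-- The ends of the representing edges which lie over the vertex `k` of the quotient. -/
abbrev RepStar (k : orbitRel.Quotient G Γ.V) : Type v :=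
  {c : orbitRel.Quotient G Γ.E × Bool // Quotient.mk _ (Γ.ends (T.eRep c.1) c.2) = k}

noncomputable instance (k : orbitRel.Quotient G Γ.V) : Fintype (T.RepStar k) :=
  @Fintype.ofFinite _ (@Subtype.finite _ (@Finite.instProd _ _
    (inferInstanceAs (Finite (Quotient _))) _) _)

/-- An end `h` of an edge `e = g ẽ` at a vertex is `g h̃` for an end `h̃` of the representing edge
`ẽ`; this is the map `h ↦ h̃`. -/
noncomputable def toRepStar (k : orbitRel.Quotient G Γ.V) (h : Γ.Star (T.vRep k)) :
    T.RepStar k :=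
  ⟨(Quotient.mk _ h.1.1, (S.moveEnd (T.elt h.1.1)⁻¹ h.1).2), by
    have h1 : T.eRep (Quotient.mk _ h.1.1) = (T.elt h.1.1)⁻¹ • h.1.1 := by
      rw [eq_inv_smul_iff, T.elt_spec]
    have h2 := S.ends_smul (T.elt h.1.1)⁻¹ h.1.1 h.1.2
    rw [h.2] at h2
    rw [h1]
    refine (congrArg (Quotient.mk (orbitRel G Γ.V)) h2).trans ?_
    exact (orbitRel.Quotient.quotient_smul_eq).trans (T.mk_vRep k)⟩

theorem toRepStar_bijective (hV : ∀ (g : G) (p : Γ.V), g • p = p → g = 1)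
    (hE : ∀ (g : G) (e : Γ.E), g • e = e → g = 1) (k : orbitRel.Quotient G Γ.V) :
    Function.Bijective (T.toRepStar S k) := by
  have key : ∀ h : Γ.E × Bool, h = S.moveEnd (T.elt h.1)
      (T.eRep (Quotient.mk _ h.1), (S.moveEnd (T.elt h.1)⁻¹ h).2) := by
    intro h
    have h1 : T.eRep (Quotient.mk _ h.1) = (T.elt h.1)⁻¹ • h.1 := by
      rw [eq_inv_smul_iff, T.elt_spec]
    have h2 : (T.eRep (Quotient.mk _ h.1), (S.moveEnd (T.elt h.1)⁻¹ h).2)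
        = S.moveEnd (T.elt h.1)⁻¹ h := Prod.ext h1 rfl
    rw [h2, ← S.moveEnd_mul, mul_inv_cancel, S.moveEnd_one]
  constructor
  · intro h h' hh
    have hh1 : (Quotient.mk _ h.1.1 : orbitRel.Quotient G Γ.E) = Quotient.mk _ h'.1.1 :=
      congrArg (fun c => c.1.1) hh
    have hh2 : (S.moveEnd (T.elt h.1.1)⁻¹ h.1).2 = (S.moveEnd (T.elt h'.1.1)⁻¹ h'.1).2 :=
      congrArg (fun c => c.1.2) hh
    have k1 := key h.1
    have k2 := key h'.1
    rw [hh1, hh2] at k1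
    set q := (T.eRep (Quotient.mk _ h'.1.1), (S.moveEnd (T.elt h'.1.1)⁻¹ h'.1).2) with hq
    have e1 : Γ.ends h.1.1 h.1.2 = T.elt h.1.1 • Γ.ends q.1 q.2 := by
      rw [← S.ends_smul]
      exact congrArg (fun z : Γ.E × Bool => Γ.ends z.1 z.2) k1
    have e2 : Γ.ends h'.1.1 h'.1.2 = T.elt h'.1.1 • Γ.ends q.1 q.2 := by
      rw [← S.ends_smul]
      exact congrArg (fun z : Γ.E × Bool => Γ.ends z.1 z.2) k2
    rw [h.2] at e1
    rw [h'.2] at e2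
    have e3 : T.elt h.1.1 = T.elt h'.1.1 := by
      have := hV ((T.elt h'.1.1)⁻¹ * T.elt h.1.1) (Γ.ends q.1 q.2)
        (by rw [mul_smul, ← e1]; exact inv_smul_eq_iff.2 e2)
      exact (inv_mul_eq_one.1 this).symm
    apply Subtype.ext
    exact k1.trans ((congrArg (fun z => S.moveEnd z q) e3).trans k2.symm)
  · rintro ⟨⟨i, b⟩, hc⟩
    have hk := hc.trans (T.mk_vRep k).symm
    obtain ⟨g, hg⟩ := Quotient.exact hk.symm
    have hg' : g • Γ.ends (T.eRep i) b = T.vRep k := hg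
    refine ⟨⟨S.moveEnd g (T.eRep i, b), ?_⟩, ?_⟩
    · exact (S.ends_smul g (T.eRep i) b).trans hg'
    · have hi : (Quotient.mk _ (g • T.eRep i) : orbitRel.Quotient G Γ.E) = i :=
        (orbitRel.Quotient.quotient_smul_eq).trans (T.mk_eRep i)
      have hs := T.elt_spec (g • T.eRep i)
      rw [hi] at hs
      have he : T.elt (g • T.eRep i) = g := by
        have := hE (g⁻¹ * T.elt (g • T.eRep i)) (T.eRep i) (by rw [mul_smul, hs, inv_smul_smul])
        exact (inv_mul_eq_one.1 this).symm
      apply Subtype.ext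
      refine Prod.ext hi ?_
      change (S.moveEnd (T.elt (g • T.eRep i))⁻¹ (S.moveEnd g (T.eRep i, b))).2 = b
      rw [he, ← S.moveEnd_mul, inv_mul_cancel, S.moveEnd_one]

variable {W : Type*} [AddCommGroup W] [Module ℂ W] (R : Representation ℂ G W) {d : ℕ}
  (β : Module.Basis (Fin d) ℂ W)

open scoped Classical in
/-- The matrix `diag([ρ(g₁⁻¹)]_β, …, [ρ(gₙ⁻¹)]_β)ᵀ`, where the `l`-th edge end at the representing
vertex belongs to the edge `g_l ẽ`. -/
noncomputable def diagMatrix (k : orbitRel.Quotient G Γ.V) :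
    Matrix (Γ.Star (T.vRep k) × Fin d) (Γ.Star (T.vRep k) × Fin d) ℂ :=
  (Matrix.of fun r c => if r.1 = c.1 then
    LinearMap.toMatrix β β (R (T.elt r.1.1.1)⁻¹) r.2 c.2 else 0)ᵀ

open scoped Classical in
/-- The matrix `Θ'`: which edge ends at the representing vertex come from which ends of the
representing edges. -/
noncomputable def theta (k : orbitRel.Quotient G Γ.V) :
    Matrix (Γ.Star (T.vRep k)) (T.RepStar k) ℂ :=
  Matrix.of fun h c => if T.toRepStar S k h = c then 1 else 0

open scoped Classical in
/-- `(X ⊗ I_d) · diag([ρ(g₁⁻¹)]_β, …, [ρ(gₙ⁻¹)]_β)ᵀ · (Θ' ⊗ I_d)`. -/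
noncomputable def boundaryMatrix (k : orbitRel.Quotient G Γ.V)
    (X : Matrix (Γ.Star (T.vRep k)) (Γ.Star (T.vRep k)) ℂ) :
    Matrix (Γ.Star (T.vRep k) × Fin d) (T.RepStar k × Fin d) ℂ :=
  (X ⊗ₖ (1 : Matrix (Fin d) (Fin d) ℂ)) * T.diagMatrix R β k *
    (T.theta S k ⊗ₖ (1 : Matrix (Fin d) (Fin d) ℂ))

/-- The edge ends at the vertex `k` of the quotient: `d` copies of each of the representing ends. -/
def starEquiv (k : orbitRel.Quotient G Γ.V) :
    (T.metricGraph d).Star k ≃ T.RepStar k × Fin d where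
  toFun h := (⟨(h.1.1.1, h.1.2), h.2⟩, h.1.1.2)
  invFun c := ⟨((c.1.1.1, c.2), c.1.1.2), c.1.2⟩
  left_inv _ := rfl
  right_inv _ := rfl

/-- The quotient quantum graph for an action which is free on the vertices and on the edges. The
rows of the boundary matrices are listed along the bijection `toRepStar`. -/
noncomputable def quotient (hV : ∀ (g : G) (p : Γ.V), g • p = p → g = 1)
    (hE : ∀ (g : G) (e : Γ.E), g • e = e → g = 1) : QuantumGraph where
  toMetricGraph := T.metricGraph d
  A k := (T.boundaryMatrix S R β k (Γ.A (T.vRep k))).submatrix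
    ((T.starEquiv k).trans
      ((Equiv.ofBijective _ (T.toRepStar_bijective S hV hE k)).symm.prodCongr (Equiv.refl _)))
    (T.starEquiv k)
  B k := (T.boundaryMatrix S R β k (Γ.B (T.vRep k))).submatrix
    ((T.starEquiv k).trans
      ((Equiv.ofBijective _ (T.toRepStar_bijective S hV hE k)).symm.prodCongr (Equiv.refl _)))
    (T.starEquiv k)

end OrbitReps

end QuantumGraph

/-! Let `R` have matrices `R(g)` in a basis `β`. An intertwiner from `R` to functions on `Γ` is the
same as an equivariant family `F_1, …, F_d`, one with `g F_j = ∑ i, R(g)_{ij} F_i`. Equivariance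
determines such a family from its values on the representing edges, and these values form one
function on the quotient graph. Conversely, a function on the quotient, extended by zero from the
representing edges and averaged with the matrix coefficients of `R`, becomes an equivariant family;
freeness on the edges ensures that the average does not change the values on the representing edges
(`restrictFamily_functionRep_average`).

The boundary matrices of the quotient are those of `Γ` at the representing vertices, with values at
the edge ends rewritten by equivariance in terms of values at ends of representing edges. So the
quotient conditions hold for the restricted function iff the original conditions hold for every
member of the family (`boundaryCondition_restrictFamily_iff`). This identifies intertwiners into an
eigenspace of `Γ` with the eigenspace of the quotient (`intertwinerEquiv`). The dimension of the
former is the scalar product of characters, because eigenspaces are finite-dimensional. Every basis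
works for this half.

Self-adjointness uses a basis in which `R` is unitary, obtained by averaging a Hermitian form. The
averaging operator is then symmetric, so extension to families has an adjoint, average and restrict
(`graphInner_extendFamily`), and extension is an isometry up to the factor `|G|`
(`card_mul_graphInner`). Both maps preserve domains and commute with the second derivative, so dense
domain, symmetry and maximality of the Laplacian of `Γ` all pass to the quotient. -/

namespace Representation

/-! ### Equivariant families and averaging over the group -/

section MatrixAverage

variable {G : Type*} [Group G] {W : Type*} [AddCommGroup W] [Module ℂ W]
  (R : Representation ℂ G W) {ι : Type*} [Fintype ι] [DecidableEq ι] (β : Module.Basis ι ℂ W)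

/-- The matrix of `R g` in a basis. -/
noncomputable abbrev basisMatrix (g : G) : Matrix ι ι ℂ := LinearMap.toMatrix β β (R g)

theorem basisMatrix_mul (g h : G) :
    R.basisMatrix β (g * h) = R.basisMatrix β g * R.basisMatrix β h := by
  rw [basisMatrix, map_mul, LinearMap.toMatrix_mul]

theorem basisMatrix_one : R.basisMatrix β 1 = 1 := by
  rw [basisMatrix, map_one, LinearMap.toMatrix_one]

theorem apply_basis (g : G) (j : ι) : R g (β j) = ∑ i, R.basisMatrix β g i j • β i := by
  conv_lhs => rw [← β.sum_repr (R g (β j))]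
  simp [LinearMap.toMatrix_apply]

variable {X : Type*} [AddCommGroup X] [Module ℂ X] (ρ : Representation ℂ G X)

/-- The family `F` transforms under `ρ` as the basis `β` does under `R`. -/
def IsEquivariantFamily (F : ι → X) : Prop :=
  ∀ g j, ρ g (F j) = ∑ i, R.basisMatrix β g i j • F i

variable {R β ρ} in
theorem IsEquivariantFamily.eq_sum_inv {F : ι → X} (hF : R.IsEquivariantFamily β ρ F) (g : G)
    (j : ι) : F j = ∑ i, R.basisMatrix β g⁻¹ i j • ρ g (F i) := by
  have h := congrArg (ρ g) (hF g⁻¹ j)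
  rw [← Module.End.mul_apply, ← map_mul, mul_inv_cancel, map_one, Module.End.one_apply] at h
  rw [h, map_sum]
  simp

variable [Fintype G]

/-- The projection (up to a factor) of a family of vectors onto the equivariant families. -/
noncomputable def matrixAverage : (ι → X) →ₗ[ℂ] (ι → X) :=
  LinearMap.pi fun i => ∑ m, ∑ g, R.basisMatrix β g⁻¹ m i • (ρ g ∘ₗ LinearMap.proj m)

theorem matrixAverage_apply (z : ι → X) (i : ι) :
    R.matrixAverage β ρ z i = ∑ m, ∑ g, R.basisMatrix β g⁻¹ m i • ρ g (z m) := by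
  simp [matrixAverage]

theorem matrixAverage_single (x : X) (i j : ι) :
    R.matrixAverage β ρ (Pi.single j x) i = ∑ g, R.basisMatrix β g⁻¹ j i • ρ g x := by
  rw [matrixAverage_apply, Finset.sum_eq_single j]
  · simp
  · intro m _ hm
    simp [hm]
  · simp

/-- Applying `ρ h` shifts the summation variable to `h * g`; the coefficient changes by `R(g⁻¹) =
R((hg)⁻¹) R(h)`, whose second factor is the matrix required by equivariance. -/
theorem isEquivariantFamily_matrixAverage (z : ι → X) :
    R.IsEquivariantFamily β ρ (R.matrixAverage β ρ z) := by
  intro h j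
  have key : ∀ m, ∑ g, R.basisMatrix β g⁻¹ m j • ρ h (ρ g (z m)) =
      ∑ g, ∑ i, R.basisMatrix β h i j • R.basisMatrix β g⁻¹ m i • ρ g (z m) := by
    intro m
    rw [← Equiv.sum_comp (Equiv.mulLeft h)
      fun g => ∑ i, R.basisMatrix β h i j • R.basisMatrix β g⁻¹ m i • ρ g (z m)]
    refine Finset.sum_congr rfl fun g _ => ?_
    simp only [smul_smul, ← Finset.sum_smul, Equiv.coe_mulLeft, map_mul, Module.End.mul_apply]
    congr 1
    have e : g⁻¹ = (h * g)⁻¹ * h := by group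
    rw [e, basisMatrix_mul, Matrix.mul_apply]
    exact Finset.sum_congr rfl fun i _ => by simp [mul_comm]
  simp only [matrixAverage_apply, map_sum, map_smul, key, Finset.smul_sum]
  rw [Finset.sum_comm' (t' := Finset.univ) (s' := fun _ => Finset.univ) (by simp)]
  rw [Finset.sum_comm]
  conv_rhs => rw [Finset.sum_comm]
  refine Finset.sum_congr rfl fun m _ => ?_
  rw [Finset.sum_comm]

-- By equivariance under `g⁻¹`, the summand of each single `g` is already `F i`.
variable {R β ρ} in
theorem IsEquivariantFamily.matrixAverage_eq {F : ι → X} (hF : R.IsEquivariantFamily β ρ F) :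
    R.matrixAverage β ρ F = (Fintype.card G : ℂ) • F := by
  funext i
  rw [matrixAverage_apply, Finset.sum_comm, Finset.sum_congr rfl
    fun g _ => (hF.eq_sum_inv g i).symm]
  simp [Nat.cast_smul_eq_nsmul]

/-- Only `g = 1` contributes, and `R(1)` is the identity matrix. This is why the average carries no
factor `1 / |G|`: later `L` evaluates at a point of a representing edge, and the values there must
be kept exactly. -/
theorem apply_matrixAverage (z : ι → X) (i : ι) {Y : Type*} [AddCommGroup Y] [Module ℂ Y]
    (L : X →ₗ[ℂ] Y) (h : ∀ g m, g ≠ 1 → L (ρ g (z m)) = 0) :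
    L (R.matrixAverage β ρ z i) = L (z i) := by
  rw [matrixAverage_apply]
  simp only [map_sum, map_smul]
  rw [Finset.sum_congr rfl fun m _ => Finset.sum_eq_single (1 : G)
    (fun g _ hg => by rw [h g m hg, smul_zero]) (by simp)]
  simp [basisMatrix_one, Matrix.one_apply]

end MatrixAverage

/-! ### Unitary bases and characters -/

/-- The averaged Hermitian form which makes a representation of a finite group unitary. -/
@[reducible] noncomputable def unitaryCore {G : Type*} [Group G] [Fintype G] {W : Type*} [AddCommGroup W]
    [Module ℂ W] (R : Representation ℂ G W) {ι : Type*} [Fintype ι] (β : Module.Basis ι ℂ W) :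
    InnerProductSpace.Core ℂ W where
  inner x y := ∑ g, ∑ i, conj (β.repr (R g x) i) * β.repr (R g y) i
  conj_inner_symm x y := by
    simp only [map_sum, map_mul, Complex.conj_conj]
    exact Finset.sum_congr rfl fun g _ => Finset.sum_congr rfl fun i _ => mul_comm _ _
  re_inner_nonneg x := by
    simp only [map_sum]
    refine Finset.sum_nonneg fun g _ => Finset.sum_nonneg fun i _ => ?_
    rw [← Complex.normSq_eq_conj_mul_self]
    exact Complex.normSq_nonneg _
  add_left x y z := by
    simp only [map_add, Finsupp.add_apply, add_mul, Finset.sum_add_distrib]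
  smul_left x y r := by
    simp only [map_smul, Finsupp.smul_apply, smul_eq_mul, map_mul, Finset.mul_sum, mul_assoc]
  definite x hx := by
    simp only [← Complex.normSq_eq_conj_mul_self] at hx
    norm_cast at hx
    rw [Finset.sum_eq_zero_iff_of_nonneg fun g _ =>
      Finset.sum_nonneg fun i _ => Complex.normSq_nonneg _] at hx
    -- The summand of the identity alone is the sum of the squared absolute values of the
    -- coordinates of `x`.
    have h1 := hx 1 (Finset.mem_univ _)
    rw [Finset.sum_eq_zero_iff_of_nonneg fun i _ => Complex.normSq_nonneg _] at h1
    apply β.repr.injective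
    ext i
    simpa using h1 i (Finset.mem_univ _)

/-- Every representation of a finite group is unitary in a suitable basis. -/
theorem exists_unitary_basis {G : Type*} [Group G] [Fintype G] {W : Type*} [AddCommGroup W]
    [Module ℂ W] [FiniteDimensional ℂ W] (R : Representation ℂ G W) :
    ∃ β : Module.Basis (Fin (Module.finrank ℂ W)) ℂ W,
      ∀ g i j, conj (R.basisMatrix β g i j) = R.basisMatrix β g⁻¹ j i := by
  let core := R.unitaryCore (Module.finBasis ℂ W)
  let : NormedAddCommGroup W := core.toNormedAddCommGroup
  let : InnerProductSpace ℂ W := InnerProductSpace.ofCore core.toCore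
  have hinv : ∀ (g : G) (x y : W), ⟪R g x, R g y⟫_ℂ = ⟪x, y⟫_ℂ := by
    intro g x y
    change ∑ k, ∑ i, conj ((Module.finBasis ℂ W).repr (R k (R g x)) i) *
      (Module.finBasis ℂ W).repr (R k (R g y)) i = ∑ k, ∑ i, _
    rw [← Equiv.sum_comp (Equiv.mulRight g) fun k => ∑ i,
      conj ((Module.finBasis ℂ W).repr (R k x) i) * (Module.finBasis ℂ W).repr (R k y) i]
    simp
  let b := stdOrthonormalBasis ℂ W
  have hb : ∀ g i j, R.basisMatrix b.toBasis g i j = ⟪b i, R g (b j)⟫_ℂ := by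
    intro g i j
    rw [basisMatrix, LinearMap.toMatrix_apply]
    simp [b.repr_apply_apply]
  refine ⟨b.toBasis, fun g i j => ?_⟩
  -- Invariance under `g⁻¹` moves the operator from one argument to the other: `⟪R g b_j, b_i⟫ =
  -- ⟪b_j, R g⁻¹ b_i⟫`.
  rw [hb, hb, inner_conj_symm, ← hinv g⁻¹, ← Module.End.mul_apply, ← map_mul, inv_mul_cancel,
    map_one, Module.End.one_apply]

theorem character_eq_sum_basisMatrix {G : Type*} [Group G] {W : Type*} [AddCommGroup W]
    [Module ℂ W] (R : Representation ℂ G W) {ι : Type*} [Fintype ι] [DecidableEq ι]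
    (β : Module.Basis ι ℂ W) (g : G) : R.character g = ∑ i, R.basisMatrix β g i i := by
  rw [character, LinearMap.trace_eq_matrix_trace ℂ β, Matrix.trace]
  rfl

theorem conj_character {G : Type*} [Group G] [Fintype G] {W : Type*} [AddCommGroup W]
    [Module ℂ W] [FiniteDimensional ℂ W] (R : Representation ℂ G W) (g : G) :
    conj (R.character g) = R.character g⁻¹ := by
  obtain ⟨β, hβ⟩ := R.exists_unitary_basis
  simp only [R.character_eq_sum_basisMatrix β, map_sum, hβ]

/-- The scalar product of characters is the dimension of the space of intertwiners. -/
theorem card_inv_mul_sum_char_mul_conj_char {G : Type*} [Group G] [Fintype G]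
    {W X : Type*} [AddCommGroup W] [Module ℂ W] [FiniteDimensional ℂ W]
    [AddCommGroup X] [Module ℂ X] [FiniteDimensional ℂ X]
    (R : Representation ℂ G W) (ρ : Representation ℂ G X) :
    (Fintype.card G : ℂ)⁻¹ * ∑ g, R.character g * conj (ρ.character g) =
      Module.finrank ℂ (IntertwiningMap R ρ) := by
  let : Invertible (Nat.card G : ℂ) := invertibleOfNonzero (by simp)
  -- Conjugating a character inverts its argument, so the two formulas match after substituting
  -- `g⁻¹` for `g`.
  rw [← card_inv_mul_sum_char_mul_char_eq_finrank, ← Equiv.sum_comp (Equiv.inv G)]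
  simp only [Equiv.inv_apply, conj_character, inv_inv, Nat.card_eq_fintype_card, mul_comm]

end Representation

/-! ### Finite sums in the domain, and eigenfunctions with `f''` normalised -/

namespace MetricGraph

variable {M : MetricGraph.{u, v}}

theorem IsSobolev.sum {ι : Type*} (s : Finset ι) {f f' f'' : ι → M.Point → ℂ}
    (h : ∀ i ∈ s, IsSobolev (f i) (f' i) (f'' i)) :
    IsSobolev (∑ i ∈ s, f i) (∑ i ∈ s, f' i) (∑ i ∈ s, f'' i) := by
  classical
  induction s using Finset.induction_on with
  | empty => simpa using IsSobolev.zero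
  | insert i s hi ih =>
    rw [Finset.sum_insert hi, Finset.sum_insert hi, Finset.sum_insert hi]
    exact (h i (Finset.mem_insert_self i s)).add
      (ih fun j hj => h j (Finset.mem_insert_of_mem hj))

end MetricGraph

namespace QuantumGraph

open MetricGraph

variable {Γ : QuantumGraph.{u, v}}

theorem InDomain.sum {ι : Type*} (s : Finset ι) {f f' f'' : ι → Γ.Point → ℂ}
    (h : ∀ i ∈ s, Γ.InDomain (f i) (f' i) (f'' i)) :
    Γ.InDomain (∑ i ∈ s, f i) (∑ i ∈ s, f' i) (∑ i ∈ s, f'' i) := by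
  classical
  induction s using Finset.induction_on with
  | empty => simpa using InDomain.zero
  | insert i s hi ih =>
    rw [Finset.sum_insert hi, Finset.sum_insert hi, Finset.sum_insert hi]
    exact (h i (Finset.mem_insert_self i s)).add
      (ih fun j hj => h j (Finset.mem_insert_of_mem hj))

/-- For a function with `-f'' = lam f` almost everywhere, `f''` may be taken to be `-lam f`. -/
theorem mem_eigenspace_iff {lam : ℂ} {f : Γ.Point → ℂ} :
    f ∈ Γ.eigenspace lam ↔ ∃ f' : Γ.Point → ℂ, Γ.InDomain f f' (-lam • f) := by
  constructor
  · rintro ⟨f', f'', hf, h⟩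
    have hae : ∀ e, onEdge f'' e =ᵐ[volume.restrict (Icc 0 (Γ.len e))] onEdge (-lam • f) e := by
      intro e
      filter_upwards [h e] with x hx
      rw [onEdge_smul, Pi.smul_apply, smul_eq_mul, neg_mul, ← hx, neg_neg]
    refine ⟨f', ⟨fun e => (hf.sobolev.memLp e).ae_eq (hae e), fun e x hx => ?_, hf.sobolev.eq⟩,
      hf.boundary⟩
    rw [hf.sobolev.deriv_eq e x hx]
    congr 1
    apply intervalIntegral.integral_congr_ae
    have h1 := (ae_restrict_iff' measurableSet_Icc).1 (hae e)
    filter_upwards [h1] with t ht hm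
    rw [uIoc_of_le hx.1] at hm
    exact ht ⟨hm.1.le, hm.2.trans hx.2⟩
  · rintro ⟨f', hf⟩
    refine ⟨f', _, hf, fun e => Filter.Eventually.of_forall fun x => ?_⟩
    rw [onEdge_smul, Pi.smul_apply, smul_eq_mul, neg_mul, neg_neg]

end QuantumGraph

/-! ### The action on derivatives and averages in the domain -/

namespace QuantumGraph.Symmetry

open MetricGraph

variable {Γ : QuantumGraph.{u, v}} {G : Type w} [Group G] [MulAction G Γ.V] [MulAction G Γ.E]
  (S : Γ.Symmetry G)

/-- The action of `G` on derivatives along the edges. -/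
def derivRep : Representation ℂ G (Γ.Point → ℂ) where
  toFun g :=
    { toFun := S.moveDeriv g
      map_add' := fun f f' => by
        funext p
        simp only [moveDeriv, Pi.add_apply]
        split <;> ring
      map_smul' := fun c f => by
        funext p
        simp only [moveDeriv, Pi.smul_apply, smul_eq_mul, RingHom.id_apply]
        split <;> ring }
  map_one' := by
    apply LinearMap.ext
    intro f
    funext p
    simp [moveDeriv, S.rev_one, S.movePoint_one]
  map_mul' g h := by
    apply LinearMap.ext
    intro f
    funext p
    have e : (S.movePoint g⁻¹ p).1.1 = g⁻¹ • p.1.1 := rfl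
    change S.moveDeriv (g * h) f p = S.moveDeriv g (S.moveDeriv h f) p
    simp only [moveDeriv, mul_inv_rev, S.movePoint_mul, S.rev_mul, e]
    cases S.rev h⁻¹ (g⁻¹ • p.1.1) <;> cases S.rev g⁻¹ p.1.1 <;> simp

section

variable [Fintype G] {W : Type*} [AddCommGroup W] [Module ℂ W] (R : Representation ℂ G W)
  {ι : Type*} [Fintype ι] [DecidableEq ι] (β : Module.Basis ι ℂ W)

/-- First derivatives change sign on reversed edges, so they are averaged with `derivRep`; functions
and second derivatives are averaged with `functionRep`. The coefficients are the same in all three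
averages. -/
theorem isSobolev_matrixAverage {z z' z'' : ι → Γ.Point → ℂ}
    (h : ∀ m, IsSobolev (z m) (z' m) (z'' m)) (i : ι) :
    IsSobolev (R.matrixAverage β S.functionRep z i) (R.matrixAverage β S.derivRep z' i)
      (R.matrixAverage β S.functionRep z'' i) := by
  simp only [Representation.matrixAverage_apply]
  exact IsSobolev.sum _ fun m _ => IsSobolev.sum _ fun g _ => (S.isSobolev_move g (h m)).smul _

theorem inDomain_matrixAverage {z z' z'' : ι → Γ.Point → ℂ}
    (h : ∀ m, Γ.InDomain (z m) (z' m) (z'' m)) (i : ι) :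
    Γ.InDomain (R.matrixAverage β S.functionRep z i) (R.matrixAverage β S.derivRep z' i)
      (R.matrixAverage β S.functionRep z'' i) := by
  simp only [Representation.matrixAverage_apply]
  exact InDomain.sum _ fun m _ => InDomain.sum _ fun g _ => (S.inDomain_move g (h m)).smul _

end

end QuantumGraph.Symmetry

/-! ### Functions on the quotient and families of functions on `Γ` -/

namespace QuantumGraph.OrbitReps

open MetricGraph MulAction

variable {Γ : QuantumGraph.{u, v}} {G : Type w} [Group G] [MulAction G Γ.V] [MulAction G Γ.E]
  (S : Γ.Symmetry G) (T : Γ.OrbitReps G) {d : ℕ}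

/-- The function on the quotient given by the values of a family of functions on the
representing edges. -/
def restrictFamily : (Fin d → Γ.Point → ℂ) →ₗ[ℂ] ((T.metricGraph d).Point → ℂ) where
  toFun F p := F p.1.1.2 ⟨(T.eRep p.1.1.1, p.1.2), p.2⟩
  map_add' _ _ := rfl
  map_smul' _ _ := rfl

theorem isSobolev_restrictFamily {F F' F'' : Fin d → Γ.Point → ℂ}
    (h : ∀ j, IsSobolev (F j) (F' j) (F'' j)) :
    IsSobolev (T.restrictFamily F) (T.restrictFamily F') (T.restrictFamily F'') where
  memLp c := (h c.2).memLp (T.eRep c.1)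
  deriv_eq c := (h c.2).deriv_eq (T.eRep c.1)
  eq c := (h c.2).eq (T.eRep c.1)

theorem endValue_restrictFamily (F : Fin d → Γ.Point → ℂ) (h : (T.metricGraph d).E × Bool) :
    endValue (T.restrictFamily F) h = endValue (F h.1.2) (T.eRep h.1.1, h.2) := rfl

theorem outDeriv_restrictFamily (F : Fin d → Γ.Point → ℂ) (h : (T.metricGraph d).E × Bool) :
    outDeriv (T.restrictFamily F) h = outDeriv (F h.1.2) (T.eRep h.1.1, h.2) := rfl

/-- The `m`-th edge of the quotient over the orbit of `e`. -/
def edgeOver (e : Γ.E) (m : Fin d) : (T.metricGraph d).E := (Quotient.mk _ e, m)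

theorem len_edgeOver (m : Fin d) {e : Γ.E} (h : T.eRep (Quotient.mk _ e) = e) :
    (T.metricGraph d).len (T.edgeOver e m) = Γ.len e := congrArg Γ.len h

open scoped Classical in
/-- A function on the quotient as a family of functions supported on the representing edges. -/
noncomputable def extendZero :
    ((T.metricGraph d).Point → ℂ) →ₗ[ℂ] (Fin d → Γ.Point → ℂ) where
  toFun u m p :=
    if h : T.eRep (Quotient.mk _ p.1.1) = p.1.1 then
      u ⟨(T.edgeOver p.1.1 m, p.1.2), by
        have := p.2
        rw [← h] at this
        exact this⟩
    else 0
  map_add' u u' := by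
    funext m p
    simp only [Pi.add_apply]
    split <;> simp
  map_smul' c u := by
    funext m p
    simp only [Pi.smul_apply, RingHom.id_apply]
    split <;> simp

theorem extendZero_apply_of_ne (u : (T.metricGraph d).Point → ℂ) (m : Fin d) (p : Γ.Point)
    (h : T.eRep (Quotient.mk _ p.1.1) ≠ p.1.1) : T.extendZero u m p = 0 := dif_neg h

theorem onEdge_extendZero (u : (T.metricGraph d).Point → ℂ) (m : Fin d) {e : Γ.E}
    (h : T.eRep (Quotient.mk _ e) = e) :
    onEdge (T.extendZero u m) e = onEdge u (T.edgeOver e m) := by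
  funext x
  have hl := T.len_edgeOver m h
  by_cases hx : x ∈ Icc (0 : ℝ) (Γ.len e)
  · rw [onEdge_of_mem _ hx, onEdge_of_mem u (by rwa [hl])]
    exact dif_pos h
  · simp only [onEdge]
    rw [dif_neg hx, dif_neg (by rwa [hl])]

theorem onEdge_extendZero_of_ne (u : (T.metricGraph d).Point → ℂ) (m : Fin d) {e : Γ.E}
    (h : T.eRep (Quotient.mk _ e) ≠ e) : onEdge (T.extendZero u m) e = 0 := by
  funext x
  by_cases hx : x ∈ Icc (0 : ℝ) (Γ.len e)
  · rw [onEdge_of_mem _ hx]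
    exact T.extendZero_apply_of_ne u m _ h
  · exact dif_neg hx

/-- Regularity is required edge by edge, with no matching at vertices, so vanishing on all other
edges does no harm. Boundary conditions may fail until the average is taken. -/
theorem isSobolev_extendZero {u u' u'' : (T.metricGraph d).Point → ℂ} (h : IsSobolev u u' u'')
    (m : Fin d) : IsSobolev (T.extendZero u m) (T.extendZero u' m) (T.extendZero u'' m) := by
  constructor <;> intro e <;> by_cases he : T.eRep (Quotient.mk _ e) = e
  · rw [T.onEdge_extendZero _ _ he, ← T.len_edgeOver m he]
    exact h.memLp _
  · rw [T.onEdge_extendZero_of_ne _ _ he]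
    exact MemLp.zero
  · rw [T.onEdge_extendZero _ _ he, T.onEdge_extendZero _ _ he, ← T.len_edgeOver m he]
    exact h.deriv_eq _
  · rw [T.onEdge_extendZero_of_ne _ _ he, T.onEdge_extendZero_of_ne _ _ he]
    simp
  · rw [T.onEdge_extendZero _ _ he, T.onEdge_extendZero _ _ he, ← T.len_edgeOver m he]
    exact h.eq _
  · rw [T.onEdge_extendZero_of_ne _ _ he, T.onEdge_extendZero_of_ne _ _ he]
    simp

theorem restrictFamily_extendZero (u : (T.metricGraph d).Point → ℂ) :
    T.restrictFamily (T.extendZero u) = u := by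
  funext p
  have h : T.eRep (Quotient.mk _ (T.eRep p.1.1.1)) = T.eRep p.1.1.1 :=
    congrArg T.eRep (T.mk_eRep _)
  have h1 : T.extendZero u p.1.1.2 ⟨(T.eRep p.1.1.1, p.1.2), p.2⟩ = _ := dif_pos h
  refine h1.trans (congrArg u (Subtype.ext ?_))
  exact Prod.ext (Prod.ext (T.mk_eRep _) rfl) rfl

variable (hE : ∀ (g : G) (e : Γ.E), g • e = e → g = 1)

include hE in
theorem eRep_ne_inv_smul {g : G} (hg : g ≠ 1) (i : orbitRel.Quotient G Γ.E) :
    T.eRep (Quotient.mk _ (g⁻¹ • T.eRep i)) ≠ g⁻¹ • T.eRep i := by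
  intro h
  have h1 : (Quotient.mk _ (g⁻¹ • T.eRep i) : orbitRel.Quotient G Γ.E) = i :=
    (orbitRel.Quotient.quotient_smul_eq).trans (T.mk_eRep i)
  rw [h1] at h
  exact hg (inv_eq_one.1 (hE g⁻¹ _ h.symm))

variable [Fintype G] {W : Type*} [AddCommGroup W] [Module ℂ W] (R : Representation ℂ G W)
  (β : Module.Basis (Fin d) ℂ W)

-- At a point of a representing edge, the summand of `g` evaluates the extension by zero on `g⁻¹`
-- times that edge. For `g ≠ 1` freeness makes this another edge of the orbit, not the representing
-- one, so the value is zero.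
include hE in
theorem restrictFamily_functionRep_average (u : (T.metricGraph d).Point → ℂ) :
    T.restrictFamily (R.matrixAverage β S.functionRep (T.extendZero u)) = u := by
  conv_rhs => rw [← T.restrictFamily_extendZero u]
  funext p
  refine R.apply_matrixAverage β S.functionRep (T.extendZero u) p.1.1.2
    (LinearMap.proj ⟨(T.eRep p.1.1.1, p.1.2), p.2⟩) fun g m hg => ?_
  exact T.extendZero_apply_of_ne u m _ (T.eRep_ne_inv_smul hE hg _)

include hE in
theorem restrictFamily_derivRep_average (u : (T.metricGraph d).Point → ℂ) :
    T.restrictFamily (R.matrixAverage β S.derivRep (T.extendZero u)) = u := by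
  conv_rhs => rw [← T.restrictFamily_extendZero u]
  funext p
  refine R.apply_matrixAverage β S.derivRep (T.extendZero u) p.1.1.2
    (LinearMap.proj ⟨(T.eRep p.1.1.1, p.1.2), p.2⟩) fun g m hg => ?_
  have h := T.extendZero_apply_of_ne u m (S.movePoint g⁻¹ ⟨(T.eRep p.1.1.1, p.1.2), p.2⟩)
    (T.eRep_ne_inv_smul hE hg _)
  change S.moveDeriv g _ _ = 0
  rw [Symmetry.moveDeriv, h]
  simp

end QuantumGraph.OrbitReps

/-! ### Boundary conditions on the quotient -/

namespace QuantumGraph.OrbitReps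

open MetricGraph MulAction

variable {Γ : QuantumGraph.{u, v}} {G : Type w} [Group G] [MulAction G Γ.V] [MulAction G Γ.E]
  (S : Γ.Symmetry G) (T : Γ.OrbitReps G) {d : ℕ} {W : Type*} [AddCommGroup W] [Module ℂ W]
  (R : Representation ℂ G W) (β : Module.Basis (Fin d) ℂ W)

theorem _root_.QuantumGraph.boundaryCondition_iff (Γ : QuantumGraph.{u, v}) (p : Γ.V)
    (x y : Γ.E × Bool → ℂ) : Γ.BoundaryCondition p x y ↔
      ∀ s, (Γ.A p *ᵥ fun h => x h.1) s + (Γ.B p *ᵥ fun h => y h.1) s = 0 :=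
  funext_iff

theorem boundaryMatrix_mulVec (k : orbitRel.Quotient G Γ.V)
    (X : Matrix (Γ.Star (T.vRep k)) (Γ.Star (T.vRep k)) ℂ) (w : T.RepStar k × Fin d → ℂ)
    (h : Γ.Star (T.vRep k)) (j : Fin d) :
    (T.boundaryMatrix S R β k X *ᵥ w) (h, j) =
      ∑ h', X h h' * ∑ i, R.basisMatrix β (T.elt h'.1.1)⁻¹ i j * w (T.toRepStar S k h', i) := by
  classical
  have h1 : ((T.theta S k ⊗ₖ (1 : Matrix (Fin d) (Fin d) ℂ)) *ᵥ w) =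
      fun r => w (T.toRepStar S k r.1, r.2) := by
    funext r
    simp [Matrix.mulVec, dotProduct, Fintype.sum_prod_type, theta, Matrix.one_apply]
  have h2 : ∀ y : Γ.Star (T.vRep k) × Fin d → ℂ, (T.diagMatrix R β k *ᵥ y) =
      fun r => ∑ i, R.basisMatrix β (T.elt r.1.1.1)⁻¹ i r.2 * y (r.1, i) := by
    intro y
    funext r
    simp [Matrix.mulVec, dotProduct, Fintype.sum_prod_type, diagMatrix]
  rw [boundaryMatrix, ← Matrix.mulVec_mulVec, ← Matrix.mulVec_mulVec, h1, h2]
  simp [Matrix.mulVec, dotProduct, Fintype.sum_prod_type, Matrix.one_apply]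

variable (hV : ∀ (g : G) (p : Γ.V), g • p = p → g = 1)
  (hE : ∀ (g : G) (e : Γ.E), g • e = e → g = 1)

/-- The hypotheses `hx` and `hy` isolate what equivariance says about data at edge ends, so that
values and outgoing derivatives are handled by one computation. Row `(h, j)` of the quotient
condition is row `h` of the original condition for the `j`-th member. -/
theorem boundaryCondition_quotient_iff (k : orbitRel.Quotient G Γ.V)
    (x y : Fin d → Γ.E × Bool → ℂ)
    (hx : ∀ g j h, x j h = ∑ i, R.basisMatrix β g i j * x i (S.moveEnd g h))
    (hy : ∀ g j h, y j h = ∑ i, R.basisMatrix β g i j * y i (S.moveEnd g h))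
    (x' y' : (T.metricGraph d).E × Bool → ℂ)
    (hx' : ∀ h, x' h = x h.1.2 (T.eRep h.1.1, h.2))
    (hy' : ∀ h, y' h = y h.1.2 (T.eRep h.1.1, h.2)) :
    (T.quotient S R β hV hE).BoundaryCondition k x' y' ↔
      ∀ j, Γ.BoundaryCondition (T.vRep k) (x j) (y j) := by
  let _ : Fintype ((T.metricGraph d).Star k) := (T.metricGraph d).instFintypeStar k
  have main : ∀ (X : Matrix (Γ.Star (T.vRep k)) (Γ.Star (T.vRep k)) ℂ)
      (z : Fin d → Γ.E × Bool → ℂ) (z' : (T.metricGraph d).E × Bool → ℂ)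
      (_ : ∀ g j h, z j h = ∑ i, R.basisMatrix β g i j * z i (S.moveEnd g h))
      (_ : ∀ h, z' h = z h.1.2 (T.eRep h.1.1, h.2)) (r : (T.metricGraph d).Star k),
      ((T.boundaryMatrix S R β k X).submatrix ((T.starEquiv k).trans
        ((Equiv.ofBijective _ (T.toRepStar_bijective S hV hE k)).symm.prodCongr (Equiv.refl _)))
        (T.starEquiv k) *ᵥ fun h => z' h.1) r =
      (X *ᵥ fun h => z (T.starEquiv k r).2 h.1)
        ((Equiv.ofBijective _ (T.toRepStar_bijective S hV hE k)).symm (T.starEquiv k r).1) := by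
    intro X z z' hz hz' r
    rw [Matrix.submatrix_mulVec_equiv]
    refine (T.boundaryMatrix_mulVec S R β k X _ _ _).trans ?_
    refine Finset.sum_congr rfl fun h _ => congrArg _ ?_
    -- For `h = g h̃` with `h̃` on a representing edge, equivariance under `g⁻¹` gives `z_j(h) = ∑
    -- i, R(g⁻¹)_{ij} z_i(h̃)`, exactly the coefficients in the diagonal block of the boundary
    -- matrix.
    refine Eq.trans ?_ (hz (T.elt h.1.1)⁻¹ _ h.1).symm
    refine Finset.sum_congr rfl fun i _ => congrArg _ ?_
    refine (hz' _).trans (congrArg (z i) (Prod.ext ?_ rfl))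
    exact eq_inv_smul_iff.2 (T.elt_spec h.1.1)
  have key : ∀ r : (T.metricGraph d).Star k, _ + _ = _ + _ := fun r =>
    congrArg₂ (· + ·) (main (Γ.A (T.vRep k)) x x' hx hx' r) (main (Γ.B (T.vRep k)) y y' hy hy' r)
  refine (boundaryCondition_iff (T.quotient S R β hV hE) k x' y').trans ?_
  simp only [boundaryCondition_iff Γ]
  constructor
  · intro h j s
    -- The row of the quotient matrix that carries row `s` of the condition for the `j`-th member.
    have h1 := (key ((T.starEquiv k).symm (T.toRepStar S k s, j))).symm.trans (h _)
    simp only [Equiv.apply_symm_apply, Equiv.ofBijective_symm_apply_apply] at h1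
    exact h1
  · exact fun h r => (key r).trans (h (T.starEquiv k r).2 _)

variable {S R β}

theorem endValue_eq_of_equivariant {F : Fin d → Γ.Point → ℂ}
    (hF : R.IsEquivariantFamily β S.functionRep F) (g : G) (j : Fin d) (h : Γ.E × Bool) :
    endValue (F j) h = ∑ i, R.basisMatrix β g i j * endValue (F i) (S.moveEnd g h) := by
  rw [← S.endValue_move g (F j) h, hF g j]
  simp [endValue]

theorem outDeriv_eq_of_equivariant {F : Fin d → Γ.Point → ℂ}
    (hF : R.IsEquivariantFamily β S.derivRep F) (g : G) (j : Fin d) (h : Γ.E × Bool) :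
    outDeriv (F j) h = ∑ i, R.basisMatrix β g i j * outDeriv (F i) (S.moveEnd g h) := by
  rw [← S.outDeriv_move g (F j) h]
  change outDeriv (S.derivRep g (F j)) _ = _
  rw [hF g j]
  simp only [outDeriv, Finset.sum_apply, Pi.smul_apply, smul_eq_mul]
  split <;> simp

theorem boundaryCondition_restrictFamily_iff {F F' : Fin d → Γ.Point → ℂ}
    (hF : R.IsEquivariantFamily β S.functionRep F)
    (hF' : R.IsEquivariantFamily β S.derivRep F') (k : orbitRel.Quotient G Γ.V) :
    (T.quotient S R β hV hE).BoundaryCondition k (endValue (T.restrictFamily F))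
        (outDeriv (T.restrictFamily F')) ↔
      ∀ j, Γ.BoundaryCondition (T.vRep k) (endValue (F j)) (outDeriv (F' j)) :=
  T.boundaryCondition_quotient_iff S R β hV hE k _ _ (endValue_eq_of_equivariant hF)
    (outDeriv_eq_of_equivariant hF') _ _ (T.endValue_restrictFamily F)
    (T.outDeriv_restrictFamily F')

/-- An equivariant family satisfies the boundary conditions everywhere if it satisfies them at the
representing vertices. -/
theorem boundaryCondition_of_equivariant {F F' : Fin d → Γ.Point → ℂ}
    (hF : R.IsEquivariantFamily β S.functionRep F)
    (hF' : R.IsEquivariantFamily β S.derivRep F')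
    (h : ∀ k j, Γ.BoundaryCondition (T.vRep k) (endValue (F j)) (outDeriv (F' j)))
    (p : Γ.V) (j : Fin d) : Γ.BoundaryCondition p (endValue (F j)) (outDeriv (F' j)) := by
  obtain ⟨g, hg⟩ := Quotient.exact (T.mk_vRep (Quotient.mk _ p)).symm
  have hg' : g • T.vRep (Quotient.mk _ p) = p := hg
  -- Pulled back along `g`, the data of `F j` near `p` become this linear combination of the data of
  -- the family near the representing vertex, and the condition is linear.
  have hb : Γ.BoundaryCondition (T.vRep (Quotient.mk _ p))
      (∑ i, R.basisMatrix β g⁻¹ i j • endValue (F i))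
      (∑ i, R.basisMatrix β g⁻¹ i j • outDeriv (F' i)) := by
    classical
    induction (Finset.univ : Finset (Fin d)) using Finset.induction_on with
    | empty =>
      change Γ.A _ *ᵥ 0 + Γ.B _ *ᵥ 0 = 0
      simp
    | insert i s hi ih =>
      rw [Finset.sum_insert hi, Finset.sum_insert hi]
      exact ((h _ i).smul _).add ih
  rw [← hg', S.boundary_smul]
  convert hb using 1
  · funext q
    rw [endValue_eq_of_equivariant hF g⁻¹ j]
    have e : (g • q.1, xor q.2 (S.rev g q.1)) = S.moveEnd g q := rfl
    simp [e, ← S.moveEnd_mul, S.moveEnd_one]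
  · funext q
    rw [outDeriv_eq_of_equivariant hF' g⁻¹ j]
    have e : (g • q.1, xor q.2 (S.rev g q.1)) = S.moveEnd g q := rfl
    simp [e, ← S.moveEnd_mul, S.moveEnd_one]

variable [Fintype G] (S R β)

/-- The averages of families in the domain restrict to the domain of the quotient. -/
theorem inDomain_restrictFamily_average {z z' z'' : Fin d → Γ.Point → ℂ}
    (h : ∀ m, Γ.InDomain (z m) (z' m) (z'' m)) :
    (T.quotient S R β hV hE).InDomain (T.restrictFamily (R.matrixAverage β S.functionRep z))
      (T.restrictFamily (R.matrixAverage β S.derivRep z'))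
      (T.restrictFamily (R.matrixAverage β S.functionRep z'')) where
  sobolev := T.isSobolev_restrictFamily
    fun j => S.isSobolev_matrixAverage R β (fun m => (h m).sobolev) j
  boundary k := (T.boundaryCondition_restrictFamily_iff hV hE
    (R.isEquivariantFamily_matrixAverage β _ z) (R.isEquivariantFamily_matrixAverage β _ z') k).2
    fun j => (S.inDomain_matrixAverage R β h j).boundary _

/-- Functions in the domain of the quotient extend to equivariant families in the domain. -/
theorem inDomain_average_extendZero {u u' u'' : (T.metricGraph d).Point → ℂ}
    (h : (T.quotient S R β hV hE).InDomain u u' u'') (j : Fin d) :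
    Γ.InDomain (R.matrixAverage β S.functionRep (T.extendZero u) j)
      (R.matrixAverage β S.derivRep (T.extendZero u') j)
      (R.matrixAverage β S.functionRep (T.extendZero u'') j) where
  sobolev := S.isSobolev_matrixAverage R β (T.isSobolev_extendZero h.sobolev) j
  boundary p := by
    refine T.boundaryCondition_of_equivariant (R.isEquivariantFamily_matrixAverage β _ _)
      (R.isEquivariantFamily_matrixAverage β _ _) (fun k => ?_) p j
    -- Both averaged families restrict to the given `u` and `u'`, so the conditions at representing
    -- vertices are those assumed on the quotient.
    rw [← T.boundaryCondition_restrictFamily_iff hV hE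
      (R.isEquivariantFamily_matrixAverage β _ _) (R.isEquivariantFamily_matrixAverage β _ _),
      T.restrictFamily_functionRep_average S hE, T.restrictFamily_derivRep_average S hE]
    exact h.boundary k

end QuantumGraph.OrbitReps

/-! ### Square-integrable functions as representatives of `L²` -/

namespace MetricGraph

variable {M : MetricGraph.{u, v}}

/-- The function `f` is square integrable on every edge. -/
def IsL2 (f : M.Point → ℂ) : Prop :=
  ∀ e, MemLp (onEdge f e) 2 (volume.restrict (Icc (0 : ℝ) (M.len e)))

/-- `f` and `g` agree almost everywhere. -/
def AEEq (f g : M.Point → ℂ) : Prop :=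
  ∀ e, onEdge f e =ᵐ[volume.restrict (Icc (0 : ℝ) (M.len e))] onEdge g e

/-- The function `f` represents the element `a` of `L²`. -/
def Represents (a : M.L2) (f : M.Point → ℂ) : Prop :=
  ∀ e, a e =ᵐ[volume.restrict (Icc (0 : ℝ) (M.len e))] onEdge f e

/-- The scalar product of two functions on the graph. -/
noncomputable def graphInner (f g : M.Point → ℂ) : ℂ :=
  ∑ e, ∫ x in (0 : ℝ)..M.len e, conj (onEdge f e x) * onEdge g e x

theorem IsL2.add {f g : M.Point → ℂ} (hf : IsL2 f) (hg : IsL2 g) : IsL2 (f + g) := fun e => by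
  rw [onEdge_add]
  exact (hf e).add (hg e)

theorem IsL2.smul {f : M.Point → ℂ} (hf : IsL2 f) (c : ℂ) : IsL2 (c • f) := fun e => by
  rw [onEdge_smul]
  exact (hf e).const_smul c

theorem isL2_zero : IsL2 (0 : M.Point → ℂ) := fun e => by
  rw [onEdge_zero]
  exact MemLp.zero

theorem IsL2.sum {ι : Type*} {s : Finset ι} {f : ι → M.Point → ℂ} (hf : ∀ i ∈ s, IsL2 (f i)) :
    IsL2 (∑ i ∈ s, f i) :=
  Finset.sum_induction _ _ (fun _ _ => IsL2.add) isL2_zero hf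

theorem IsSobolev.isL2_snd {f f' f'' : M.Point → ℂ} (h : IsSobolev f f' f'') : IsL2 f'' :=
  h.memLp

theorem IsSobolev.isL2 {f f' f'' : M.Point → ℂ} (h : IsSobolev f f' f'') : IsL2 f := fun e => by
  have hc := h.continuousOn e
  obtain ⟨C, hC⟩ := isCompact_Icc.exists_bound_of_continuousOn hc
  exact MemLp.of_bound (hc.aestronglyMeasurable measurableSet_Icc) C
    ((ae_restrict_iff' measurableSet_Icc).2 (Filter.Eventually.of_forall hC))

theorem IsL2.exists_represents {f : M.Point → ℂ} (hf : IsL2 f) : ∃ a : M.L2, Represents a f :=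
  ⟨WithLp.toLp 2 fun e => (hf e).toLp _, fun e => (hf e).coeFn_toLp⟩

/-- Restriction, extension and averaging are defined on functions given at every point, so elements
of `L²` enter through such representatives. -/
theorem exists_isL2_represents (a : M.L2) : ∃ f : M.Point → ℂ, IsL2 f ∧ Represents a f := by
  let f : M.Point → ℂ := fun p => a p.1.1 p.1.2
  have h : Represents a f := fun e => by
    filter_upwards [ae_restrict_mem measurableSet_Icc] with x hx
    exact (onEdge_of_mem f hx).symm
  exact ⟨f, fun e => (Lp.memLp (a e)).ae_eq (h e), h⟩

theorem Represents.add {a b : M.L2} {f g : M.Point → ℂ} (ha : Represents a f)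
    (hb : Represents b g) : Represents (a + b) (f + g) := fun e => by
  rw [onEdge_add]
  exact (Lp.coeFn_add (a e) (b e)).trans ((ha e).add (hb e))

theorem Represents.smul {a : M.L2} {f : M.Point → ℂ} (ha : Represents a f) (c : ℂ) :
    Represents (c • a) (c • f) := fun e => by
  rw [onEdge_smul]
  exact (Lp.coeFn_smul c (a e)).trans ((ha e).const_smul c)

theorem Represents.congr {a : M.L2} {f g : M.Point → ℂ} (ha : Represents a f) (h : AEEq f g) :
    Represents a g := fun e => (ha e).trans (h e)

theorem Represents.aeEq {a : M.L2} {f g : M.Point → ℂ} (hf : Represents a f)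
    (hg : Represents a g) : AEEq f g := fun e => (hf e).symm.trans (hg e)

theorem represents_zero : Represents (0 : M.L2) 0 := fun e => by
  rw [onEdge_zero]
  exact Lp.coeFn_zero _ _ _

theorem Represents.unique {a b : M.L2} {f : M.Point → ℂ} (ha : Represents a f)
    (hb : Represents b f) : a = b := by
  ext e : 1
  exact Lp.ext ((ha e).trans (hb e).symm)

theorem Represents.inner_eq {a b : M.L2} {f g : M.Point → ℂ} (ha : Represents a f)
    (hb : Represents b g) : ⟪a, b⟫_ℂ = graphInner f g := by
  rw [PiLp.inner_apply, graphInner]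
  refine Finset.sum_congr rfl fun e _ => ?_
  rw [L2.inner_def, intervalIntegral.integral_of_le (M.len_pos e).le, ← integral_Icc_eq_integral_Ioc]
  apply integral_congr_ae
  filter_upwards [ha e, hb e] with x h1 h2
  rw [h1, h2, RCLike.inner_apply']

/-- Inherited from the Hilbert space through representatives, as are the sesquilinearity rules that
follow. -/
theorem conj_graphInner {f g : M.Point → ℂ} (hf : IsL2 f) (hg : IsL2 g) :
    conj (graphInner f g) = graphInner g f := by
  obtain ⟨a, ha⟩ := hf.exists_represents
  obtain ⟨b, hb⟩ := hg.exists_represents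
  rw [← ha.inner_eq hb, ← hb.inner_eq ha, inner_conj_symm]

theorem graphInner_add_right {f g h : M.Point → ℂ} (hf : IsL2 f) (hg : IsL2 g) (hh : IsL2 h) :
    graphInner f (g + h) = graphInner f g + graphInner f h := by
  obtain ⟨a, ha⟩ := hf.exists_represents
  obtain ⟨b, hb⟩ := hg.exists_represents
  obtain ⟨c, hc⟩ := hh.exists_represents
  rw [← ha.inner_eq hb, ← ha.inner_eq hc, ← ha.inner_eq (hb.add hc), inner_add_right]

theorem graphInner_smul_right {f g : M.Point → ℂ} (hf : IsL2 f) (hg : IsL2 g) (c : ℂ) :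
    graphInner f (c • g) = c * graphInner f g := by
  obtain ⟨a, ha⟩ := hf.exists_represents
  obtain ⟨b, hb⟩ := hg.exists_represents
  rw [← ha.inner_eq hb, ← ha.inner_eq (hb.smul c), inner_smul_right]

theorem graphInner_sum_right {ι : Type*} {s : Finset ι} {f : M.Point → ℂ} {g : ι → M.Point → ℂ}
    (hf : IsL2 f) (hg : ∀ i, IsL2 (g i)) :
    graphInner f (∑ i ∈ s, g i) = ∑ i ∈ s, graphInner f (g i) := by
  classical
  induction s using Finset.induction_on with
  | empty => simp [graphInner, onEdge_zero]
  | insert i s hi ih =>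
    rw [Finset.sum_insert hi, Finset.sum_insert hi,
      graphInner_add_right hf (hg i) (IsL2.sum fun j _ => hg j), ih]

theorem graphInner_smul_left {f g : M.Point → ℂ} (hf : IsL2 f) (hg : IsL2 g) (c : ℂ) :
    graphInner (c • f) g = conj c * graphInner f g := by
  rw [← conj_graphInner hg (hf.smul c), graphInner_smul_right hg hf, map_mul,
    conj_graphInner hg hf]

theorem graphInner_sum_left {ι : Type*} {s : Finset ι} {f : ι → M.Point → ℂ} {g : M.Point → ℂ}
    (hf : ∀ i, IsL2 (f i)) (hg : IsL2 g) :
    graphInner (∑ i ∈ s, f i) g = ∑ i ∈ s, graphInner (f i) g := by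
  rw [← conj_graphInner hg (IsL2.sum fun j _ => hf j), graphInner_sum_right hg hf, map_sum]
  exact Finset.sum_congr rfl fun i _ => conj_graphInner hg (hf i)

theorem AEEq.add {f f' g g' : M.Point → ℂ} (h : AEEq f f') (h' : AEEq g g') :
    AEEq (f + g) (f' + g') := fun e => by
  rw [onEdge_add, onEdge_add]
  exact (h e).add (h' e)

theorem AEEq.smul {f g : M.Point → ℂ} (h : AEEq f g) (c : ℂ) : AEEq (c • f) (c • g) :=
  fun e => by
    rw [onEdge_smul, onEdge_smul]
    exact (h e).const_smul c

theorem AEEq.sum {ι : Type*} {s : Finset ι} {f g : ι → M.Point → ℂ}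
    (h : ∀ i, AEEq (f i) (g i)) : AEEq (∑ i ∈ s, f i) (∑ i ∈ s, g i) := by
  classical
  induction s using Finset.induction_on with
  | empty => exact fun e => Filter.EventuallyEq.rfl
  | insert i s hi ih =>
    rw [Finset.sum_insert hi, Finset.sum_insert hi]
    exact (h i).add ih

end MetricGraph

/-! ### Self-adjointness in terms of the graph of the Laplacian -/

namespace QuantumGraph

open MetricGraph

variable {Γ : QuantumGraph.{u, v}}

theorem mem_laplacianGraph_iff {P : Γ.L2 × Γ.L2} :
    P ∈ Γ.laplacianGraph ↔ ∃ f f' f'' : Γ.Point → ℂ, Γ.InDomain f f' f'' ∧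
      Represents P.1 f ∧ Represents P.2 ((-1 : ℂ) • f'') := by
  have h : ∀ f'' : Γ.Point → ℂ, ∀ e x, onEdge ((-1 : ℂ) • f'') e x = - onEdge f'' e x := by
    intro f'' e x
    rw [onEdge_smul, Pi.smul_apply, neg_one_smul]
  constructor
  · rintro ⟨f, f', f'', hf, hP⟩
    refine ⟨f, f', f'', hf, fun e => (hP e).1, fun e => ?_⟩
    filter_upwards [(hP e).2] with x hx
    rw [hx, h]
  · rintro ⟨f, f', f'', hf, h1, h2⟩
    refine ⟨f, f', f'', hf, fun e => ⟨h1 e, ?_⟩⟩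
    filter_upwards [h2 e] with x hx
    rw [hx, h]

theorem InDomain.exists_mem_laplacianGraph {f f' f'' : Γ.Point → ℂ} (h : Γ.InDomain f f' f'') :
    ∃ a b : Γ.L2, (a, b) ∈ Γ.laplacianGraph ∧ Represents a f ∧
      Represents b ((-1 : ℂ) • f'') := by
  obtain ⟨a, ha⟩ := h.sobolev.isL2.exists_represents
  obtain ⟨b, hb⟩ := (h.sobolev.isL2_snd.smul (-1)).exists_represents
  exact ⟨a, b, mem_laplacianGraph_iff.2 ⟨f, f', f'', h, ha, hb⟩, ha, hb⟩

theorem mem_laplacian_domain_iff {a : Γ.L2} :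
    a ∈ Γ.laplacian.domain ↔ ∃ b, (a, b) ∈ Γ.laplacianGraph := by
  rw [← Γ.graph_laplacian, LinearPMap.mem_domain_iff]

/-- The adjoint operator is meaningful only for a dense domain; given density, its graph is the
adjoint of the graph. Density is expressed as triviality of the orthogonal complement, which
transfers by adjoint maps. -/
theorem isSelfAdjoint_laplacian_iff :
    IsSelfAdjoint Γ.laplacian ↔
      (∀ u : Γ.L2, (∀ P ∈ Γ.laplacianGraph, ⟪P.1, u⟫_ℂ = 0) → u = 0) ∧
        Γ.laplacianGraph.adjoint = Γ.laplacianGraph := by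
  have hd : Dense (Γ.laplacian.domain : Set Γ.L2) ↔
      ∀ u : Γ.L2, (∀ P ∈ Γ.laplacianGraph, ⟪P.1, u⟫_ℂ = 0) → u = 0 := by
    rw [Submodule.dense_iff_topologicalClosure_eq_top, Submodule.topologicalClosure_eq_top_iff,
      Submodule.eq_bot_iff]
    refine forall_congr' fun u => imp_congr_left ?_
    rw [Submodule.mem_orthogonal]
    constructor
    · exact fun h P hP => h P.1 (mem_laplacian_domain_iff.2 ⟨P.2, hP⟩)
    · intro h a ha
      obtain ⟨b, hb⟩ := mem_laplacian_domain_iff.1 ha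
      exact h _ hb
  rw [← hd, ← Γ.graph_laplacian]
  constructor
  · intro h
    refine ⟨h.dense_domain, ?_⟩
    rw [← LinearPMap.adjoint_graph_eq_graph_adjoint h.dense_domain,
      LinearPMap.isSelfAdjoint_def.1 h]
  · rintro ⟨h1, h2⟩
    rw [LinearPMap.isSelfAdjoint_def]
    apply LinearPMap.eq_of_eq_graph
    rw [LinearPMap.adjoint_graph_eq_graph_adjoint h1, h2]

end QuantumGraph

/-! ### Unitarity of the action and symmetry of the average -/

namespace QuantumGraph.Symmetry

open MetricGraph

variable {Γ : QuantumGraph.{u, v}} {G : Type w} [Group G] [MulAction G Γ.V] [MulAction G Γ.E]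
  (S : Γ.Symmetry G)

theorem measurePreserving_reflect (l : ℝ) : MeasurePreserving (fun x : ℝ => l - x)
    (volume.restrict (Icc 0 l)) (volume.restrict (Icc 0 l)) := by
  have := (Measure.measurePreserving_sub_left (volume : Measure ℝ) l).restrict_preimage
    (s := Icc 0 l) measurableSet_Icc
  simpa using this

theorem isL2_functionRep (g : G) {f : Γ.Point → ℂ} (hf : IsL2 f) :
    IsL2 (S.functionRep g f) := fun e => by
  have hm := hf (g⁻¹ • e)
  rw [S.len_smul] at hm
  rw [show onEdge (S.functionRep g f) e = _ from funext (S.onEdge_functionRep g f e)]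
  cases hr : S.rev g⁻¹ e
  · simpa using hm
  · simp only [if_true]
    exact hm.comp_measurePreserving (measurePreserving_reflect _)

theorem aeEq_functionRep (g : G) {f f' : Γ.Point → ℂ} (h : AEEq f f') :
    AEEq (S.functionRep g f) (S.functionRep g f') := fun e => by
  have he := h (g⁻¹ • e)
  rw [S.len_smul] at he
  rw [show onEdge (S.functionRep g f) e = _ from funext (S.onEdge_functionRep g f e),
    show onEdge (S.functionRep g f') e = _ from funext (S.onEdge_functionRep g f' e)]
  cases hr : S.rev g⁻¹ e
  · simpa using he
  · simp only [if_true]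
    exact (measurePreserving_reflect _).quasiMeasurePreserving.ae he

/-- The action on `L²` is unitary. -/
theorem graphInner_functionRep (g : G) (f f' : Γ.Point → ℂ) :
    graphInner (S.functionRep g f) (S.functionRep g f') = graphInner f f' := by
  rw [graphInner, graphInner, ← Equiv.sum_comp (MulAction.toPerm g⁻¹ : Equiv.Perm Γ.E)
    fun e => ∫ x in (0 : ℝ)..Γ.len e, conj (onEdge f e x) * onEdge f' e x]
  refine Finset.sum_congr rfl fun e _ => ?_
  simp only [MulAction.toPerm_apply, S.len_smul, onEdge_functionRep]
  cases S.rev g⁻¹ e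
  · simp
  · simp only [if_true]
    rw [intervalIntegral.integral_comp_sub_left
      fun x => conj (onEdge f (g⁻¹ • e) x) * onEdge f' (g⁻¹ • e) x]
    simp

theorem graphInner_functionRep_left (g : G) (f f' : Γ.Point → ℂ) :
    graphInner (S.functionRep g f) f' = graphInner f (S.functionRep g⁻¹ f') := by
  rw [← S.graphInner_functionRep g f, ← Module.End.mul_apply, ← map_mul, mul_inv_cancel,
    map_one, Module.End.one_apply]

variable [Fintype G] {W : Type*} [AddCommGroup W] [Module ℂ W] (R : Representation ℂ G W)
  {ι : Type*} [Fintype ι] [DecidableEq ι] (β : Module.Basis ι ℂ W)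

theorem isL2_matrixAverage {z : ι → Γ.Point → ℂ} (hz : ∀ m, IsL2 (z m)) (i : ι) :
    IsL2 (R.matrixAverage β S.functionRep z i) := by
  rw [Representation.matrixAverage_apply]
  exact IsL2.sum fun m _ => IsL2.sum fun g _ => (S.isL2_functionRep g (hz m)).smul _

theorem aeEq_matrixAverage {z z' : ι → Γ.Point → ℂ} (h : ∀ m, AEEq (z m) (z' m)) (i : ι) :
    AEEq (R.matrixAverage β S.functionRep z i) (R.matrixAverage β S.functionRep z' i) := by
  simp only [Representation.matrixAverage_apply]
  exact AEEq.sum fun m => AEEq.sum fun g => (S.aeEq_functionRep g (h m)).smul _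

/-- The average is symmetric for the sum of the scalar products of the members: moving `g` across
gives `g⁻¹`, conjugating the coefficient gives the transposed matrix of the inverse by `hβ`, and the
substitution `g ↦ g⁻¹` restores the form of the average. -/
theorem graphInner_matrixAverage_left
    (hβ : ∀ g i j, conj (R.basisMatrix β g i j) = R.basisMatrix β g⁻¹ j i)
    {z : ι → Γ.Point → ℂ} (hz : ∀ m, IsL2 (z m)) {a : Γ.Point → ℂ} (ha : IsL2 a) (j : ι) :
    graphInner (R.matrixAverage β S.functionRep z j) a =
      ∑ m, graphInner (z m) (R.matrixAverage β S.functionRep (Pi.single j a) m) := by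
  simp only [Representation.matrixAverage_apply R β S.functionRep z,
    Representation.matrixAverage_single]
  rw [graphInner_sum_left
    (fun m => IsL2.sum fun g _ => (S.isL2_functionRep g (hz m)).smul _) ha]
  refine Finset.sum_congr rfl fun m _ => ?_
  rw [graphInner_sum_left (fun g => (S.isL2_functionRep g (hz m)).smul _) ha,
    graphInner_sum_right (hz m) fun g => (S.isL2_functionRep g ha).smul _,
    ← Equiv.sum_comp (Equiv.inv G) fun g => graphInner (z m) _]
  refine Finset.sum_congr rfl fun g _ => ?_
  rw [graphInner_smul_left (S.isL2_functionRep g (hz m)) ha,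
    graphInner_smul_right (hz m) (S.isL2_functionRep _ ha), hβ, graphInner_functionRep_left]
  rfl

end QuantumGraph.Symmetry

/-! ### Self-adjointness of the quotient -/

namespace QuantumGraph.OrbitReps

open MetricGraph MulAction

variable {Γ : QuantumGraph.{u, v}} {G : Type w} [Group G] [MulAction G Γ.V] [MulAction G Γ.E]
  (S : Γ.Symmetry G) (T : Γ.OrbitReps G) {d : ℕ}

theorem isL2_extendZero {u : (T.metricGraph d).Point → ℂ} (hu : IsL2 u) (m : Fin d) :
    IsL2 (T.extendZero u m) := fun e => by
  by_cases he : T.eRep (Quotient.mk _ e) = e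
  · rw [T.onEdge_extendZero _ _ he, ← T.len_edgeOver m he]
    exact hu _
  · rw [T.onEdge_extendZero_of_ne _ _ he]
    exact MemLp.zero

theorem isL2_restrictFamily {F : Fin d → Γ.Point → ℂ} (hF : ∀ j, IsL2 (F j)) :
    IsL2 (T.restrictFamily F) := fun c => hF c.2 (T.eRep c.1)

theorem aeEq_restrictFamily {F F' : Fin d → Γ.Point → ℂ} (h : ∀ j, AEEq (F j) (F' j)) :
    AEEq (T.restrictFamily F) (T.restrictFamily F') := fun c => h c.2 (T.eRep c.1)

/-- `extendZero` is adjoint to `restrictFamily`. -/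
theorem sum_graphInner_extendZero (u : (T.metricGraph d).Point → ℂ) (F : Fin d → Γ.Point → ℂ) :
    ∑ m, graphInner (T.extendZero u m) (F m) = graphInner u (T.restrictFamily F) := by
  simp only [graphInner]
  rw [← Fintype.sum_prod_type' (f := fun m e => ∫ x in (0 : ℝ)..Γ.len e,
    conj (onEdge (T.extendZero u m) e x) * onEdge (F m) e x)]
  symm
  -- Pairs `(m, e)` with `e` a representing edge correspond to the edges of the quotient; all other
  -- pairs contribute zero.
  refine Fintype.sum_of_injective
    (fun c : (T.metricGraph d).E => ((c.2, T.eRep c.1) : Fin d × Γ.E)) ?_ _ _ ?_ ?_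
  · intro c c' h
    have h1 : T.eRep c.1 = T.eRep c'.1 := congrArg Prod.snd h
    have h2 : c.2 = c'.2 := congrArg Prod.fst h
    refine Prod.ext ?_ h2
    rw [← T.mk_eRep c.1, h1, T.mk_eRep]
  · rintro ⟨m, e⟩ h
    have he : T.eRep (Quotient.mk _ e) ≠ e := fun he => h ⟨T.edgeOver e m, Prod.ext rfl he⟩
    simp [T.onEdge_extendZero_of_ne u m he]
  · intro c
    have hc : T.edgeOver (T.eRep c.1) c.2 = c := Prod.ext (T.mk_eRep c.1) rfl
    have h := T.onEdge_extendZero u c.2 (congrArg T.eRep (T.mk_eRep c.1))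
    rw [hc] at h
    simp only [h]
    rfl

variable [Fintype G] {W : Type*} [AddCommGroup W] [Module ℂ W] (R : Representation ℂ G W)
  (β : Module.Basis (Fin d) ℂ W)

/-- A function on the quotient as an equivariant family of functions. -/
noncomputable def extendFamily :
    ((T.metricGraph d).Point → ℂ) →ₗ[ℂ] (Fin d → Γ.Point → ℂ) :=
  R.matrixAverage β S.functionRep ∘ₗ T.extendZero

/-- The component `j` of the adjoint of `extendFamily`. -/
noncomputable def averageRestrict (j : Fin d) :
    (Γ.Point → ℂ) →ₗ[ℂ] ((T.metricGraph d).Point → ℂ) :=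
  T.restrictFamily ∘ₗ R.matrixAverage β S.functionRep ∘ₗ LinearMap.single ℂ (fun _ => Γ.Point → ℂ) j

theorem isEquivariantFamily_extendFamily (u : (T.metricGraph d).Point → ℂ) :
    R.IsEquivariantFamily β S.functionRep (T.extendFamily S R β u) :=
  R.isEquivariantFamily_matrixAverage β _ _

theorem isL2_extendFamily {u : (T.metricGraph d).Point → ℂ} (hu : IsL2 u) (j : Fin d) :
    IsL2 (T.extendFamily S R β u j) :=
  S.isL2_matrixAverage R β (T.isL2_extendZero hu) j

theorem isL2_averageRestrict {a : Γ.Point → ℂ} (ha : IsL2 a) (j : Fin d) :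
    IsL2 (T.averageRestrict S R β j a) := by
  refine T.isL2_restrictFamily fun i => S.isL2_matrixAverage R β (fun m => ?_) i
  rcases eq_or_ne m j with rfl | hm
  · simpa using ha
  · simpa [hm] using isL2_zero

theorem graphInner_extendFamily
    (hβ : ∀ g i j, conj (R.basisMatrix β g i j) = R.basisMatrix β g⁻¹ j i)
    {u : (T.metricGraph d).Point → ℂ} (hu : IsL2 u) {a : Γ.Point → ℂ} (ha : IsL2 a)
    (j : Fin d) :
    graphInner (T.extendFamily S R β u j) a = graphInner u (T.averageRestrict S R β j a) :=
  (S.graphInner_matrixAverage_left R β hβ (T.isL2_extendZero hu) ha j).trans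
    (T.sum_graphInner_extendZero u _)

theorem sum_averageRestrict (F : Fin d → Γ.Point → ℂ) :
    ∑ j, T.averageRestrict S R β j (F j) =
      T.restrictFamily (R.matrixAverage β S.functionRep F) := by
  simp only [averageRestrict, LinearMap.comp_apply, ← map_sum]
  congr 2
  funext j
  simp [Finset.sum_apply, Pi.single_apply]

variable (hV : ∀ (g : G) (p : Γ.V), g • p = p → g = 1)
  (hE : ∀ (g : G) (e : Γ.E), g • e = e → g = 1)

include hE in
theorem restrictFamily_extendFamily (u : (T.metricGraph d).Point → ℂ) :
    T.restrictFamily (T.extendFamily S R β u) = u :=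
  T.restrictFamily_functionRep_average S hE R β u

include hE in
theorem sum_averageRestrict_extendFamily (u : (T.metricGraph d).Point → ℂ) :
    ∑ j, T.averageRestrict S R β j (T.extendFamily S R β u j) = (Fintype.card G : ℂ) • u := by
  rw [T.sum_averageRestrict, (T.isEquivariantFamily_extendFamily S R β u).matrixAverage_eq,
    map_smul, T.restrictFamily_extendFamily S R β hE]

-- Extension followed by the sum of its componentwise adjoints is `|G|` times the identity, so
-- extension is an isometry up to scale.
include hE in
theorem card_mul_graphInner
    (hβ : ∀ g i j, conj (R.basisMatrix β g i j) = R.basisMatrix β g⁻¹ j i)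
    {u w : (T.metricGraph d).Point → ℂ} (hu : IsL2 u) (hw : IsL2 w) :
    (Fintype.card G : ℂ) * graphInner u w =
      ∑ j, graphInner (T.extendFamily S R β u j) (T.extendFamily S R β w j) := by
  rw [← graphInner_smul_right hu hw, ← T.sum_averageRestrict_extendFamily S R β hE w,
    graphInner_sum_right hu
      fun j => T.isL2_averageRestrict S R β (T.isL2_extendFamily S R β hw j) j]
  exact Finset.sum_congr rfl fun j _ =>
    (T.graphInner_extendFamily S R β hβ hu (T.isL2_extendFamily S R β hw j) j).symm

theorem exists_inDomain_averageRestrict (j : Fin d) {a a' a'' : Γ.Point → ℂ}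
    (h : Γ.InDomain a a' a'') :
    ∃ b', (T.quotient S R β hV hE).InDomain (T.averageRestrict S R β j a) b'
      (T.averageRestrict S R β j a'') := by
  refine ⟨_, T.inDomain_restrictFamily_average S R β hV hE (z := Pi.single j a)
    (z' := Pi.single j a') (z'' := Pi.single j a'') fun m => ?_⟩
  rcases eq_or_ne m j with rfl | hm
  · simpa using h
  · simpa [hm] using InDomain.zero

omit [Fintype G] in
theorem mem_laplacianGraph_quotient_iff {a b : (T.metricGraph d).L2} :
    (a, b) ∈ (T.quotient S R β hV hE).laplacianGraph ↔
      ∃ f f' f'' : (T.metricGraph d).Point → ℂ, (T.quotient S R β hV hE).InDomain f f' f'' ∧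
        Represents a f ∧ Represents b ((-1 : ℂ) • f'') :=
  mem_laplacianGraph_iff

/-- The Laplacian of the quotient is self-adjoint if the basis is unitary. -/
theorem isSelfAdjoint_laplacian_quotient (hΓ : IsSelfAdjoint Γ.laplacian)
    (hβ : ∀ g i j, conj (R.basisMatrix β g i j) = R.basisMatrix β g⁻¹ j i) :
    IsSelfAdjoint (T.quotient S R β hV hE).laplacian := by
  rw [isSelfAdjoint_laplacian_iff] at hΓ ⊢
  obtain ⟨hd, hs⟩ := hΓ
  have hcard : (Fintype.card G : ℂ) ≠ 0 := Nat.cast_ne_zero.2 Fintype.card_ne_zero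
  refine ⟨fun u hu => ?_, le_antisymm ?_ ?_⟩
  -- Density: if `u` is orthogonal to the domain of the quotient, each member of its extension is
  -- orthogonal to the domain of `Γ`, because the adjoint `averageRestrict` maps domain to domain.
  -- So the extension vanishes almost everywhere, and so does its restriction `u`.
  · obtain ⟨f, hf, hfu⟩ := exists_isL2_represents (M := T.metricGraph d) u
    have hz : ∀ j, AEEq (T.extendFamily S R β f j) 0 := by
      intro j
      obtain ⟨w, hw⟩ := (T.isL2_extendFamily S R β hf j).exists_represents
      have hw0 : w = 0 := hd w fun P hP => by
        obtain ⟨a, a', a'', ha, h1, h2⟩ := mem_laplacianGraph_iff.1 hP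
        obtain ⟨b', hb⟩ := T.exists_inDomain_averageRestrict S R β hV hE j ha
        obtain ⟨p, q, hpq, hp, hq⟩ := hb.exists_mem_laplacianGraph
        rw [← inner_conj_symm, hw.inner_eq h1,
          T.graphInner_extendFamily S R β hβ hf ha.sobolev.isL2]
        refine (congrArg conj (hfu.inner_eq hp).symm).trans ?_
        exact (inner_conj_symm (𝕜 := ℂ) p u).trans (hu _ hpq)
      rw [hw0] at hw
      exact hw.aeEq represents_zero
    have h0 := T.aeEq_restrictFamily hz
    rw [T.restrictFamily_extendFamily S R β hE] at h0
    exact (hfu.congr h0).unique represents_zero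
  · rintro ⟨u, t⟩ hut
    rw [Submodule.mem_adjoint_iff] at hut
    obtain ⟨f, hf, hfu⟩ := exists_isL2_represents (M := T.metricGraph d) u
    obtain ⟨h, hh, hht⟩ := exists_isL2_represents (M := T.metricGraph d) t
    -- The adjoint is contained in the graph: testing against domain functions of `Γ` reduces to
    -- testing `(u, t)` against their images under `averageRestrict`, so the extended pair lies in
    -- the adjoint for `Γ`, which is its graph.
    have key : ∀ j, ∃ F F' F'' : Γ.Point → ℂ, Γ.InDomain F F' F'' ∧
        AEEq F (T.extendFamily S R β f j) ∧
        AEEq ((-1 : ℂ) • F'') (T.extendFamily S R β h j) := by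
      intro j
      obtain ⟨w, hw⟩ := (T.isL2_extendFamily S R β hf j).exists_represents
      obtain ⟨y, hy⟩ := (T.isL2_extendFamily S R β hh j).exists_represents
      have hwy : (w, y) ∈ Γ.laplacianGraph := by
        rw [← hs, Submodule.mem_adjoint_iff]
        intro a c hac
        obtain ⟨α, α', α'', hα, h1, h2⟩ := mem_laplacianGraph_iff.1 hac
        obtain ⟨b', hb⟩ := T.exists_inDomain_averageRestrict S R β hV hE j hα
        obtain ⟨p, q, hpq, hp, hq⟩ := hb.exists_mem_laplacianGraph
        have e1 : ⟪u, q⟫_ℂ = ⟪w, c⟫_ℂ := by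
          rw [hw.inner_eq h2,
            T.graphInner_extendFamily S R β hβ hf (hα.sobolev.isL2_snd.smul _), map_smul]
          exact hfu.inner_eq hq
        have e2 : ⟪t, p⟫_ℂ = ⟪y, a⟫_ℂ := by
          rw [hy.inner_eq h1, T.graphInner_extendFamily S R β hβ hh hα.sobolev.isL2]
          exact hht.inner_eq hp
        have e3 := hut p q hpq
        rw [← inner_conj_symm, ← inner_conj_symm p, e1, e2, inner_conj_symm,
          inner_conj_symm] at e3
        exact e3
      obtain ⟨F, F', F'', hF, h1, h2⟩ := mem_laplacianGraph_iff.1 hwy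
      exact ⟨F, F', F'', hF, h1.aeEq hw, h2.aeEq hy⟩
    choose F F' F'' hF h1 h2 using key
    -- The chosen `F j` agree with an equivariant family only almost everywhere, so they need not be
    -- equivariant at the vertices. Averaging makes them so and multiplies the classes by `|G|`,
    -- which is divided out at the end.
    have hQ := T.inDomain_restrictFamily_average S R β hV hE hF
    have e1 := T.aeEq_restrictFamily fun j => S.aeEq_matrixAverage R β h1 j
    have e2 := T.aeEq_restrictFamily fun j => S.aeEq_matrixAverage R β h2 j
    rw [(T.isEquivariantFamily_extendFamily S R β f).matrixAverage_eq, map_smul,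
      T.restrictFamily_extendFamily S R β hE] at e1
    rw [(T.isEquivariantFamily_extendFamily S R β h).matrixAverage_eq, map_smul,
      T.restrictFamily_extendFamily S R β hE,
      show (fun j => (-1 : ℂ) • F'' j) = (-1 : ℂ) • F'' from rfl, map_smul, map_smul] at e2
    obtain ⟨p, q, hpq, hp, hq⟩ := hQ.exists_mem_laplacianGraph
    have hp' : p = (Fintype.card G : ℂ) • u := (Represents.congr hp e1).unique (hfu.smul _)
    have hq' : q = (Fintype.card G : ℂ) • t := (Represents.congr hq e2).unique (hht.smul _)
    have := (T.quotient S R β hV hE).laplacianGraph.smul_mem (Fintype.card G : ℂ)⁻¹ hpq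
    rw [hp', hq', Prod.smul_mk, inv_smul_smul₀ hcard, inv_smul_smul₀ hcard] at this
    exact this
  · rintro ⟨u, t⟩ hut
    rw [Submodule.mem_adjoint_iff]
    intro a c hac
    obtain ⟨f, f', f'', hf, h1, h2⟩ := (T.mem_laplacianGraph_quotient_iff S R β hV hE).1 hut
    obtain ⟨k, k', k'', hk, h3, h4⟩ := (T.mem_laplacianGraph_quotient_iff S R β hV hE).1 hac
    have hf2 := hf.sobolev.isL2
    have hf3 : IsL2 ((-1 : ℂ) • f'') := hf.sobolev.isL2_snd.smul (-1)
    have hk2 := hk.sobolev.isL2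
    have hk3 : IsL2 ((-1 : ℂ) • k'') := hk.sobolev.isL2_snd.smul (-1)
    rw [sub_eq_zero]
    refine (h4.inner_eq h1).trans (Eq.trans ?_ (h3.inner_eq h2).symm)
    -- Symmetry: up to the factor `|G|`, both scalar products are sums over the extended families,
    -- whose members lie in the domain of `Γ`; there symmetry holds for each `j`.
    apply mul_left_cancel₀ hcard
    refine (T.card_mul_graphInner S R β hE hβ hk3 hf2).trans
      (Eq.trans ?_ (T.card_mul_graphInner S R β hE hβ hk2 hf3).symm)
    refine Finset.sum_congr rfl fun j _ => ?_
    obtain ⟨p, q, hpq, hp, hq⟩ :=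
      (T.inDomain_average_extendZero S R β hV hE hf j).exists_mem_laplacianGraph
    obtain ⟨x, y, hxy, hx, hy⟩ :=
      (T.inDomain_average_extendZero S R β hV hE hk j).exists_mem_laplacianGraph
    rw [← hs, Submodule.mem_adjoint_iff] at hpq
    have h5 := sub_eq_zero.1 (hpq _ _ hxy)
    rw [hy.inner_eq hp, hx.inner_eq hq] at h5
    rw [map_smul, map_smul]
    exact h5

end QuantumGraph.OrbitReps

/-! ### Finite dimension of the eigenspaces -/

namespace QuantumGraph

open MetricGraph

variable {Γ : QuantumGraph.{u, v}}

/-- Uniqueness for `f'' = c f`, written as a system of integral equations. -/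
theorem eqOn_zero_of_integral_system {F F' : ℝ → ℂ} {c : ℂ} {l : ℝ}
    (hF : ContinuousOn F (Icc 0 l)) (hF' : ContinuousOn F' (Icc 0 l))
    (h0 : F 0 = 0) (h0' : F' 0 = 0)
    (h : ∀ x ∈ Icc (0 : ℝ) l, F x = F 0 + ∫ t in (0 : ℝ)..x, F' t)
    (h' : ∀ x ∈ Icc (0 : ℝ) l, F' x = F' 0 + ∫ t in (0 : ℝ)..x, c * F t) :
    ∀ x ∈ Icc (0 : ℝ) l, F x = 0 := by
  -- The integral equations hold only on `[0, l]`; right derivatives on `[0, l)` are available there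
  -- and suffice for uniqueness of solutions.
  have key : ∀ {H K : ℝ → ℂ}, ContinuousOn K (Icc 0 l) →
      (∀ x ∈ Icc (0 : ℝ) l, H x = H 0 + ∫ t in (0 : ℝ)..x, K t) →
      ∀ t ∈ Ico (0 : ℝ) l, HasDerivWithinAt H (K t) (Ici t) t := by
    intro H K hK hH t ht
    have hn : Icc t l ∈ nhdsWithin t (Ioi t) := Icc_mem_nhdsGT ht.2
    have h1 : HasDerivWithinAt (fun y => H 0 + ∫ s in (0 : ℝ)..y, K s) (K t) (Ici t) t := by
      refine HasDerivWithinAt.const_add _ ?_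
      have hKt : ContinuousOn K (Icc t l) := hK.mono (Icc_subset_Icc_left ht.1)
      refine intervalIntegral.integral_hasDerivWithinAt_right (t := Ioi t) ?_ ?_ ?_
      · apply ContinuousOn.intervalIntegrable
        rw [uIcc_of_le ht.1]
        exact hK.mono (Icc_subset_Icc_right ht.2.le)
      · exact ⟨Icc t l, hn, hKt.aestronglyMeasurable measurableSet_Icc⟩
      · exact ((hKt t ⟨le_rfl, ht.2.le⟩).mono_of_mem_nhdsWithin hn)
    refine h1.congr_of_eventuallyEq_of_mem ?_ self_mem_Ici
    filter_upwards [Icc_mem_nhdsGE ht.2] with y hy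
    exact hH y ⟨ht.1.trans hy.1, hy.2⟩
  have hd := key hF' h
  have hd' := key (continuousOn_const.mul hF) h'
  -- The first-order system `(F, F') ↦ (F', c F)`; being linear and bounded it is Lipschitz.
  let L : ℂ × ℂ →L[ℝ] ℂ × ℂ :=
    (ContinuousLinearMap.snd ℝ ℂ ℂ).prod (ContinuousLinearMap.mul ℝ ℂ c ∘L
      ContinuousLinearMap.fst ℝ ℂ ℂ)
  have hu := ODE_solution_unique (v := fun _ => L) (f := fun t => (F t, F' t))
    (g := fun _ => (0 : ℂ × ℂ)) (K := ‖L‖₊) (a := 0) (b := l) (fun _ => L.lipschitz)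
    (hF.prodMk hF') (fun t ht => (hd t ht).prodMk (hd' t ht)) continuousOn_const
    (fun t _ => by simpa using hasDerivWithinAt_const t (Ici t) (0 : ℂ × ℂ)) (by simp [h0, h0'])
  exact fun x hx => congrArg Prod.fst (hu hx)

theorem InDomain.eq_zero_of_initial {lam : ℂ} {f f' : Γ.Point → ℂ}
    (h : Γ.InDomain f f' (-lam • f)) (h0 : ∀ e, onEdge f e 0 = 0)
    (h0' : ∀ e, onEdge f' e 0 = 0) : f = 0 := by
  funext p
  have hp := p.2
  have h1 := eqOn_zero_of_integral_system (c := -lam)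
    (h.sobolev.continuousOn p.1.1) (h.sobolev.continuousOn_fst p.1.1) (h0 _) (h0' _)
    (h.sobolev.eq p.1.1) (fun x hx => by
      rw [h.sobolev.deriv_eq p.1.1 x hx, onEdge_smul]
      rfl) p.1.2 hp
  rwa [onEdge_of_mem f hp] at h1

/-- Eigenfunctions together with their derivatives. -/
def eigenPairs (Γ : QuantumGraph.{u, v}) (lam : ℂ) :
    Submodule ℂ ((Γ.Point → ℂ) × (Γ.Point → ℂ)) where
  carrier := {P | Γ.InDomain P.1 P.2 (-lam • P.1)}
  zero_mem' := by simpa using InDomain.zero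
  add_mem' {P Q} hP hQ := by simpa [add_comm] using InDomain.add hP hQ
  smul_mem' c P hP := by
    have := InDomain.smul c hP
    rwa [smul_comm] at this

/-- An eigenfunction is determined by its value and derivative at the point `0` of every edge, `2
|E|` numbers in all. -/
instance finiteDimensional_eigenspace (lam : ℂ) : FiniteDimensional ℂ (Γ.eigenspace lam) := by
  let init : ((Γ.Point → ℂ) × (Γ.Point → ℂ)) →ₗ[ℂ] (Γ.E → ℂ × ℂ) :=
    LinearMap.pi fun e => LinearMap.prodMap
      (LinearMap.proj ⟨(e, 0), zero_mem_edge e⟩) (LinearMap.proj ⟨(e, 0), zero_mem_edge e⟩)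
  let N : Submodule ℂ ((Γ.Point → ℂ) × (Γ.Point → ℂ)) := Γ.eigenPairs lam
  have hker : ∀ P ∈ N, init P = 0 → P.1 = 0 := by
    intro P hP h0
    refine InDomain.eq_zero_of_initial hP (fun e => ?_) fun e => ?_
    · rw [onEdge_of_mem _ (zero_mem_edge e)]
      exact congrArg Prod.fst (congrFun h0 e)
    · rw [onEdge_of_mem _ (zero_mem_edge e)]
      exact congrArg Prod.snd (congrFun h0 e)
  have hmap : Γ.eigenspace lam = N.map (LinearMap.fst ℂ _ _) := by
    ext f
    rw [mem_eigenspace_iff]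
    constructor
    · rintro ⟨f', hf⟩
      exact ⟨(f, f'), hf, rfl⟩
    · rintro ⟨P, hP, rfl⟩
      exact ⟨P.2, hP⟩
  -- The projection to `f` factors through the initial data, so its image is a quotient of a
  -- finite-dimensional space.
  have hle : LinearMap.ker (init ∘ₗ N.subtype) ≤
      LinearMap.ker (LinearMap.fst ℂ (Γ.Point → ℂ) (Γ.Point → ℂ) ∘ₗ N.subtype) :=
    fun P hP => hker P.1 P.2 hP
  have hr : N.map (LinearMap.fst ℂ _ _) =
      LinearMap.range (LinearMap.fst ℂ (Γ.Point → ℂ) (Γ.Point → ℂ) ∘ₗ N.subtype) := by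
    rw [LinearMap.range_comp, Submodule.range_subtype]
  have hfin : FiniteDimensional ℂ (N ⧸ LinearMap.ker (init ∘ₗ N.subtype)) :=
    (init ∘ₗ N.subtype).quotKerEquivRange.symm.finiteDimensional
  rw [hmap, hr]
  have : FiniteDimensional ℂ (N ⧸ LinearMap.ker
      (LinearMap.fst ℂ (Γ.Point → ℂ) (Γ.Point → ℂ) ∘ₗ N.subtype)) :=
    Module.Finite.of_surjective (Submodule.factor hle) (Submodule.factor_surjective hle)
  exact (LinearMap.fst ℂ (Γ.Point → ℂ) (Γ.Point → ℂ) ∘ₗ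
    N.subtype).quotKerEquivRange.finiteDimensional

end QuantumGraph

/-! ### The spectrum of the quotient -/

namespace QuantumGraph.OrbitReps

open MetricGraph MulAction Representation

variable {Γ : QuantumGraph.{u, v}} {G : Type w} [Group G] [MulAction G Γ.V] [MulAction G Γ.E]
  (S : Γ.Symmetry G) (T : Γ.OrbitReps G) {d : ℕ} {W : Type*} [AddCommGroup W] [Module ℂ W]
  (R : Representation ℂ G W) (β : Module.Basis (Fin d) ℂ W)

/-- Equivariant families with the same values on the representing edges are equal. -/
theorem restrictFamily_injOn {F F' : Fin d → Γ.Point → ℂ}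
    (hF : R.IsEquivariantFamily β S.functionRep F) (hF' : R.IsEquivariantFamily β S.functionRep F')
    (h : T.restrictFamily F = T.restrictFamily F') : F = F' := by
  funext j p
  have hg := T.elt_spec p.1.1
  set g := T.elt p.1.1
  have he : T.eRep (Quotient.mk _ p.1.1) = (S.movePoint g⁻¹ p).1.1 := eq_inv_smul_iff.2 hg
  have key : ∀ i, F i (S.movePoint g⁻¹ p) = F' i (S.movePoint g⁻¹ p) := by
    intro i
    have hp := (S.movePoint g⁻¹ p).2
    rw [← he] at hp
    have h1 := congrFun h ⟨(T.edgeOver p.1.1 i, (S.movePoint g⁻¹ p).1.2), hp⟩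
    have h2 : (⟨(T.eRep (Quotient.mk _ p.1.1), (S.movePoint g⁻¹ p).1.2), hp⟩ : Γ.Point) =
        S.movePoint g⁻¹ p := Subtype.ext (Prod.ext he rfl)
    rw [← h2]
    exact h1
  rw [hF.eq_sum_inv g j, hF'.eq_sum_inv g j, Finset.sum_apply, Finset.sum_apply]
  exact Finset.sum_congr rfl fun i _ =>
    congrArg (R.basisMatrix β g⁻¹ i j • ·) (key i)

theorem isEquivariantFamily_of_intertwining {lam : ℂ}
    (φ : IntertwiningMap R (S.eigenRep lam)) :
    R.IsEquivariantFamily β S.functionRep fun j => (φ (β j) : Γ.Point → ℂ) := by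
  intro g j
  have h := φ.isIntertwining _ _ g (β j)
  rw [R.apply_basis β, map_sum] at h
  have h1 := congrArg Subtype.val h
  simp only [map_smul, Submodule.coe_sum, Submodule.coe_smul] at h1
  exact h1.symm

variable [Fintype G] (hV : ∀ (g : G) (p : Γ.V), g • p = p → g = 1)
  (hE : ∀ (g : G) (e : Γ.E), g • e = e → g = 1)

theorem extendFamily_mem_eigenspace {lam : ℂ} {u : (T.metricGraph d).Point → ℂ}
    (hu : u ∈ (T.quotient S R β hV hE).eigenspace lam) (j : Fin d) :
    T.extendFamily S R β u j ∈ Γ.eigenspace lam := by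
  obtain ⟨u', hu'⟩ := mem_eigenspace_iff.1 hu
  have h := T.inDomain_average_extendZero S R β hV hE hu' j
  refine mem_eigenspace_iff.2 ⟨R.matrixAverage β S.derivRep (T.extendZero u') j, ?_⟩
  have h1 : T.extendFamily S R β ((-lam) • u) j = -lam • T.extendFamily S R β u j := by
    rw [map_smul]
    rfl
  rw [← h1]
  exact h

theorem restrictFamily_mem_eigenspace {lam : ℂ} {F : Fin d → Γ.Point → ℂ}
    (hF : R.IsEquivariantFamily β S.functionRep F) (hm : ∀ j, F j ∈ Γ.eigenspace lam) :
    T.restrictFamily F ∈ (T.quotient S R β hV hE).eigenspace lam := by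
  choose F' hF' using fun j => mem_eigenspace_iff.1 (hm j)
  have hcard : (Fintype.card G : ℂ) ≠ 0 := Nat.cast_ne_zero.2 Fintype.card_ne_zero
  -- The chosen derivatives `F'` are not known to be equivariant, so they are averaged together with
  -- `F`, which only scales `F` by `|G|`.
  have h := T.inDomain_restrictFamily_average S R β hV hE hF'
  have e1 : T.restrictFamily (R.matrixAverage β S.functionRep fun j => -lam • F j) =
      -lam • T.restrictFamily (R.matrixAverage β S.functionRep F) := by
    rw [← map_smul, ← map_smul]
    rfl
  have h1 : T.restrictFamily (R.matrixAverage β S.functionRep F) ∈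
      (T.quotient S R β hV hE).eigenspace lam := by
    refine mem_eigenspace_iff.2 ⟨T.restrictFamily (R.matrixAverage β S.derivRep F'), ?_⟩
    have h2 := h
    rw [e1] at h2
    exact h2
  rw [hF.matrixAverage_eq, map_smul] at h1
  have h3 := ((T.quotient S R β hV hE).eigenspace lam).smul_mem (Fintype.card G : ℂ)⁻¹ h1
  have h4 : (Fintype.card G : ℂ)⁻¹ • (Fintype.card G : ℂ) • T.restrictFamily F =
      T.restrictFamily F := inv_smul_smul₀ hcard _
  rw [← h4]
  exact h3

/-- Intertwiners from `R` to an eigenspace restrict to eigenfunctions of the quotient. -/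
noncomputable def intertwinerEquiv (lam : ℂ) :
    IntertwiningMap R (S.eigenRep lam) ≃ₗ[ℂ] (T.quotient S R β hV hE).eigenspace lam := by
  refine LinearEquiv.ofBijective
    { toFun := fun φ => ⟨T.restrictFamily fun j => (φ (β j) : Γ.Point → ℂ),
        T.restrictFamily_mem_eigenspace S R β hV hE
          (isEquivariantFamily_of_intertwining S R β φ) fun j => (φ (β j)).2⟩
      map_add' := fun _ _ => rfl
      map_smul' := fun _ _ => rfl } ⟨fun φ ψ h => ?_, fun u => ?_⟩
  · have h1 := T.restrictFamily_injOn S R β (isEquivariantFamily_of_intertwining S R β φ)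
      (isEquivariantFamily_of_intertwining S R β ψ) (congrArg Subtype.val h)
    exact IntertwiningMap.ext (β.ext fun j => Subtype.ext (congrFun h1 j))
  -- Surjectivity: the extended family prescribes `φ` on the basis; its equivariance is the
  -- intertwining property.
  · let φ : W →ₗ[ℂ] Γ.eigenspace lam := β.constr ℂ fun j =>
      ⟨T.extendFamily S R β u.1 j, T.extendFamily_mem_eigenspace S R β hV hE u.2 j⟩
    have hφ : ∀ j, (φ (β j) : Γ.Point → ℂ) = T.extendFamily S R β u.1 j := fun j =>
      congrArg Subtype.val (β.constr_basis ℂ _ j)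
    refine ⟨⟨φ, fun g => β.ext fun j => Subtype.ext ?_⟩, Subtype.ext ?_⟩
    · have h1 := T.isEquivariantFamily_extendFamily S R β u.1 g j
      rw [← hφ j] at h1
      refine Eq.trans ?_ h1.symm
      rw [LinearMap.comp_apply, R.apply_basis β, map_sum, Submodule.coe_sum]
      exact Finset.sum_congr rfl fun i _ => by rw [map_smul, Submodule.coe_smul, hφ]
    · exact (congrArg T.restrictFamily (funext hφ)).trans
        (T.restrictFamily_extendFamily S R β hE u.1)

theorem isQuotientGraph_quotient [FiniteDimensional ℂ W] :
    S.IsQuotientGraph R (T.quotient S R β hV hE) := fun lam => by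
  rw [Symmetry.repSpectrum, card_inv_mul_sum_char_mul_conj_char,
    (T.intertwinerEquiv S R β hV hE lam).finrank_eq]
  rfl

end QuantumGraph.OrbitReps

theorem mainTheorem7 (Γ : QuantumGraph.{u, v}) {G : Type w} [Group G] [Fintype G]
    [MulAction G Γ.V] [MulAction G Γ.E] (S : Γ.Symmetry G)
    (hV : ∀ (g : G) (p : Γ.V), g • p = p → g = 1)
    (hE : ∀ (g : G) (e : Γ.E), g • e = e → g = 1)
    (hΓ : IsSelfAdjoint Γ.laplacian)
    {W : Type*} [AddCommGroup W] [Module ℂ W] [FiniteDimensional ℂ W]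
    (R : Representation ℂ G W) (T : Γ.OrbitReps G) :
    ∃ β : Module.Basis (Fin (Module.finrank ℂ W)) ℂ W,
      S.IsQuotientGraph R (T.quotient S R β hV hE) ∧
      IsSelfAdjoint (T.quotient S R β hV hE).laplacian := by
  obtain ⟨β, hβ⟩ := R.exists_unitary_basis
  exact ⟨β, T.isQuotientGraph_quotient S R β hV hE,
    T.isSelfAdjoint_laplacian_quotient S R β hV hE hΓ hβ⟩
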